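/- Let $F$ be a nonarchimedean local field of residual characteristic $2$ (and of any characteristic), with ring of integers $\mathcal R$, maximal ideal $\mathcal P$, residue field $\mathfrak f=\mathcal R/\mathcal P$ and a fixed uniformizer $\varpi$. Let $\psi$ be an additive character of $F$ with conductor $\mathcal P$, that is, trivial on $\mathcal P$ and nontrivial on $\mathcal R$. Put $\mathcal K'=\mathrm{SL}(2,\mathcal R)$. Let $\sigma$ be a cuspidal complex representation of $\mathrm{SL}(2,\mathfrak f)$, that is, an irreducible one with no nonzero vector fixed by the unipotent radical of a Borel subgroup, and inflate $\sigma$ to $\mathcal K'$ through reduction modulo $\mathcal P$. Let $\ell\ge 1$ be an integer and put $m=\lceil \ell/2\rceil$, $m'=\lfloor \ell/2\rfloor+1$ and $g_\ell=\mathrm{diag}(\varpi^\ell,1)$. Let $B'_\ell$ be the subgroup of the matrices of $\mathcal K'$ that are lower triangular modulo $\mathcal P^\ell$, let ${}^{g_\ell}\sigma(h)=\sigma(g_\ell^{-1}hg_\ell)$ for $h\in B'_\ell$, and let $$\sigma(\ell)=\mathrm{Ind}_{B'_\ell}^{\mathcal K'}\,{}^{g_\ell}\sigma ,$$ the $\ell$-th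 Mackey component of the restriction to $\mathcal K'$ of the depth-zero supercuspidal representation of $\mathrm{SL}(2,F)$ compactly induced from $\sigma$ (for $\ell$ even) or from ${}^{g_1}\sigma$ (for $\ell$ odd). Let $Z_0$ be the group of scalar matrices in $\mathrm{GL}(2,\mathcal R)$, let $U_0$ be the group of lower triangular unipotent matrices in $\mathrm{GL}(2,\mathcal R)$, and let $\mathcal K_{m,m'}$ be the group of matrices in $\mathrm{GL}(2,\mathcal R)$ with diagonal entries in $1+\mathcal P^m$ and off-diagonal entries in $\mathcal P^{m'}$. Put $\Gamma'(\ell)=Z_0U_0\mathcal K_{m,m'}\cap \mathcal K'$. For $u\in\mathcal R^\times$, the formula $g\mapsto\psi(u\varpi^{-\ell}g_{11}^{-1}g_{12})$ defines a character of $\Gamma'(\ell)$; let $I(\mathbf 1,u,\ell)$ be the representation of $\mathcal K'$ induced from it. Let $\mathcal S_m\subset\mathcal R^\times$ be any set of representatives of $\mathcal R^\times/(\mathcal R^\times)^2(1+\mathcal P^m)$. Then, as representations of $\mathcal K'$, $$\sigma(\ell)\;\cong\;\bigoplus_{u\in\mathcal S_{\lceil \ell/2\rceil}} I(\mathbf 1,u,\ell),$$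 and the representations $I(\mathbf 1,u,\ell)$, $u\in\mathcal S_{\lceil \ell/2\rceil}$, are irreducible and pairwise non-isomorphic. -/

import Mathlib

open scoped ValuativeRel MatrixGroups Pointwise

/-! ### Subgroups of `GL(2, R)` and `SL(2, R)` for a local ring `R` with maximal ideal `P` -/

section LocalRing

variable {R : Type*} [CommRing R] [IsLocalRing R]

/-- The `n`-th power `P ^ n` of the maximal ideal of `R`. -/
abbrev maxPow (R : Type*) [CommRing R] [IsLocalRing R] (n : ℕ) : Ideal R :=
  IsLocalRing.maximalIdeal R ^ n

/-- `m = ⌈ℓ / 2⌉`. -/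
abbrev halfCeil (ℓ : ℕ) : ℕ := (ℓ + 1) / 2

/-- `m' = ⌊ℓ / 2⌋ + 1`, the least integer greater than `ℓ / 2`. -/
abbrev halfSucc (ℓ : ℕ) : ℕ := ℓ / 2 + 1

/-- `B'_ℓ`: the matrices of `SL(2, R)` that are lower triangular modulo `P ^ ℓ`. -/
def lowerTriMod (R : Type*) [CommRing R] [IsLocalRing R] (ℓ : ℕ) : Subgroup SL(2, R) where
  carrier := {g | g 0 1 ∈ maxPow R ℓ}
  one_mem' := by simp
  mul_mem' := by
    intro a b ha hb
    simp only [Set.mem_ofPred_eq, Matrix.SpecialLinearGroup.coe_mul, Matrix.mul_apply,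
      Fin.sum_univ_two] at *
    exact add_mem (Ideal.mul_mem_left _ _ hb) (Ideal.mul_mem_right _ _ ha)
  inv_mem' := by
    intro a ha
    rw [Matrix.SpecialLinearGroup.SL2_inv_expl]
    exact (neg_mem (show a 0 1 ∈ maxPow R ℓ from ha) : -a 0 1 ∈ maxPow R ℓ)

/-- `Z₀`: the scalar matrices in `GL(2, R)`. -/
abbrev scalarSubgroup (R : Type*) [CommRing R] : Subgroup (GL (Fin 2) R) :=
  (Matrix.GeneralLinearGroup.scalar (Fin 2) : Rˣ →* GL (Fin 2) R).range

/-- `U₀`: the lower triangular matrices in `GL(2, R)` with diagonal entries `1`. -/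
def lowerUnipotent (R : Type*) [CommRing R] : Subgroup (GL (Fin 2) R) where
  carrier := {g | g 0 0 = 1 ∧ g 0 1 = 0 ∧ g 1 1 = 1}
  one_mem' := by simp
  mul_mem' := by
    rintro a b ⟨h1, h2, h3⟩ ⟨h4, h5, h6⟩
    simp [Matrix.mul_apply, Fin.sum_univ_two, *]
  inv_mem' := by
    rintro a ⟨h1, h2, h3⟩
    have hdet : (a : Matrix (Fin 2) (Fin 2) R).det = 1 := by
      simp [Matrix.det_fin_two, h1, h2, h3]
    simp only [Set.mem_ofPred_eq, Matrix.coe_units_inv, Matrix.inv_def, Matrix.adjugate_fin_two,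
      hdet]
    simp [h1, h2, h3]

theorem maxPow_halfSucc_le (ℓ : ℕ) : maxPow R (halfSucc ℓ) ≤ maxPow R (halfCeil ℓ) :=
  Ideal.pow_le_pow_right (by unfold halfCeil halfSucc; omega)

/-- `K_{m, m'}`: the matrices of `GL(2, R)` with diagonal entries in `1 + P ^ m` and
off-diagonal entries in `P ^ m'`, where `m = ⌈ℓ / 2⌉` and `m' = ⌊ℓ / 2⌋ + 1`. -/
def congrSubgroup (R : Type*) [CommRing R] [IsLocalRing R] (ℓ : ℕ) :
    Subgroup (GL (Fin 2) R) where
  carrier := {g | g 0 0 - 1 ∈ maxPow R (halfCeil ℓ) ∧ g 0 1 ∈ maxPow R (halfSucc ℓ) ∧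
    g 1 0 ∈ maxPow R (halfSucc ℓ) ∧ g 1 1 - 1 ∈ maxPow R (halfCeil ℓ)}
  one_mem' := by simp
  mul_mem' := by
    rintro a b ⟨h1, h2, h3, h4⟩ ⟨k1, k2, k3, k4⟩
    have hle := maxPow_halfSucc_le (R := R) ℓ
    simp only [Set.mem_ofPred_eq, Units.val_mul, Matrix.mul_apply, Fin.sum_univ_two]
    refine ⟨?_, ?_, ?_, ?_⟩
    · have := add_mem (add_mem (Ideal.mul_mem_right (b 0 0) _ h1) k1)
        (Ideal.mul_mem_right (b 1 0) _ (hle h2))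
      convert this using 1; ring
    · exact add_mem (Ideal.mul_mem_left _ _ k2) (Ideal.mul_mem_right _ _ h2)
    · exact add_mem (Ideal.mul_mem_right _ _ h3) (Ideal.mul_mem_left _ _ k3)
    · have := add_mem (add_mem (Ideal.mul_mem_right (b 1 1) _ h4) k4)
        (Ideal.mul_mem_right (b 0 1) _ (hle h3))
      convert this using 1; ring
  inv_mem' := by
    rintro a ⟨h1, h2, h3, h4⟩
    have hle := maxPow_halfSucc_le (R := R) ℓ
    have hu : Ring.inverse (a : Matrix (Fin 2) (Fin 2) R).det *
        (a 0 0 * a 1 1 - a 0 1 * a 1 0) = 1 := by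
      have := Ring.inverse_mul_cancel _ (Matrix.isUnits_det_units a)
      rwa [Matrix.det_fin_two a.val] at this ⊢
    simp only [Set.mem_ofPred_eq, Matrix.coe_units_inv, Matrix.inv_def, Matrix.adjugate_fin_two]
    generalize Ring.inverse (a : Matrix (Fin 2) (Fin 2) R).det = d at *
    simp only [Matrix.smul_apply, Matrix.of_apply, Matrix.cons_val', Matrix.cons_val_zero,
      Matrix.cons_val_one, Matrix.cons_val_fin_one, smul_eq_mul]
    refine ⟨?_, Ideal.mul_mem_left _ _ (neg_mem h2), Ideal.mul_mem_left _ _ (neg_mem h3), ?_⟩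
    · have := add_mem (Ideal.mul_mem_left _ (-(d * a 1 1)) h1)
        (Ideal.mul_mem_left _ (d * a 1 0) (hle h2))
      convert this using 1
      linear_combination hu
    · have := add_mem (Ideal.mul_mem_left _ (-(d * a 0 0)) h4)
        (Ideal.mul_mem_left _ (d * a 1 0) (hle h2))
      convert this using 1
      linear_combination hu

/-- Auxiliary: the matrices `g` of `GL(2, R)` with `g₁₂ ∈ P ^ m'` and `g₁₁ - g₂₂ ∈ P ^ m`;
`coe_intGroupAux` identifies it with the product `Z₀ U₀ K_{m, m'}`. -/
def intGroupAux (R : Type*) [CommRing R] [IsLocalRing R] (ℓ : ℕ) : Subgroup (GL (Fin 2) R) where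
  carrier := {g | g 0 1 ∈ maxPow R (halfSucc ℓ) ∧ g 0 0 - g 1 1 ∈ maxPow R (halfCeil ℓ)}
  one_mem' := by simp
  mul_mem' := by
    rintro a b ⟨h1, h2⟩ ⟨k1, k2⟩
    have hle := maxPow_halfSucc_le (R := R) ℓ
    simp only [Set.mem_ofPred_eq, Units.val_mul, Matrix.mul_apply, Fin.sum_univ_two]
    refine ⟨add_mem (Ideal.mul_mem_left _ _ k1) (Ideal.mul_mem_right _ _ h1), ?_⟩
    have := add_mem (add_mem (Ideal.mul_mem_right (b 0 0) _ h2)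
      (Ideal.mul_mem_left _ (a 1 1) k2)) (sub_mem (Ideal.mul_mem_right (b 1 0) _ (hle h1))
        (Ideal.mul_mem_left _ (a 1 0) (hle k1)))
    convert this using 1; ring
  inv_mem' := by
    rintro a ⟨h1, h2⟩
    simp only [Set.mem_ofPred_eq, Matrix.coe_units_inv, Matrix.inv_def, Matrix.adjugate_fin_two]
    generalize Ring.inverse (a : Matrix (Fin 2) (Fin 2) R).det = d at *
    simp only [Matrix.smul_apply, Matrix.of_apply, Matrix.cons_val', Matrix.cons_val_zero,
      Matrix.cons_val_one, Matrix.cons_val_fin_one, smul_eq_mul]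
    refine ⟨Ideal.mul_mem_left _ _ (neg_mem h1), ?_⟩
    have := Ideal.mul_mem_left _ (-d) h2
    convert this using 1; ring

theorem isUnit_apply_zero_zero {ℓ : ℕ} {g : GL (Fin 2) R} (hg : g ∈ intGroupAux R ℓ) :
    IsUnit (g 0 0) := by
  have h1 : g 0 1 ∈ IsLocalRing.maximalIdeal R :=
    Ideal.pow_le_self (by unfold halfSucc; omega) hg.1
  have h2 : IsUnit (g 0 0 * g 1 1 - g 0 1 * g 1 0) := by
    have := Matrix.isUnits_det_units g
    rwa [Matrix.det_fin_two] at this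
  by_contra h
  have h3 : g 0 0 ∈ IsLocalRing.maximalIdeal R := h
  exact (sub_mem (Ideal.mul_mem_right _ _ h3) (Ideal.mul_mem_right _ _ h1) :
    g 0 0 * g 1 1 - g 0 1 * g 1 0 ∈ IsLocalRing.maximalIdeal R) h2

theorem coe_intGroupAux (ℓ : ℕ) :
    (scalarSubgroup R : Set (GL (Fin 2) R)) * lowerUnipotent R * congrSubgroup R ℓ =
      intGroupAux R ℓ := by
  have hle := maxPow_halfSucc_le (R := R) ℓ
  have hZ : scalarSubgroup R ≤ intGroupAux R ℓ := by
    rintro _ ⟨z, rfl⟩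
    constructor <;> simp [Matrix.GeneralLinearGroup.scalar]
  have hU : lowerUnipotent R ≤ intGroupAux R ℓ := by
    rintro g ⟨h1, h2, h3⟩
    constructor <;> simp [h1, h2, h3]
  have hK : congrSubgroup R ℓ ≤ intGroupAux R ℓ := by
    rintro g ⟨h1, h2, h3, h4⟩
    refine ⟨h2, ?_⟩
    have := sub_mem h1 h4
    convert this using 1; ring
  apply Set.Subset.antisymm
  · rintro _ ⟨_, ⟨z, hz, c, hc, rfl⟩, k, hk, rfl⟩
    exact mul_mem (mul_mem (hZ hz) (hU hc)) (hK hk)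
  · intro g hg
    obtain ⟨z, hz⟩ := isUnit_apply_zero_zero hg
    let c' : SL(2, R) := ⟨!![1, 0; (↑z⁻¹ : R) * g 1 0, 1], by simp [Matrix.det_fin_two]⟩
    let c : GL (Fin 2) R := Matrix.SpecialLinearGroup.toGL c'
    let s : GL (Fin 2) R := Matrix.GeneralLinearGroup.scalar (Fin 2) z
    have hc : c ∈ lowerUnipotent R := ⟨rfl, rfl, rfl⟩
    refine ⟨s * c, ⟨s, ⟨z, rfl⟩, c, hc, rfl⟩, (s * c)⁻¹ * g, ?_, by group⟩
    have hzz : (↑z⁻¹ : R) * g 0 0 = 1 := by rw [← hz]; simp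
    have hci : ((c⁻¹ : GL (Fin 2) R) : Matrix (Fin 2) (Fin 2) R) =
        !![1, 0; -((↑z⁻¹ : R) * g 1 0), 1] := by
      rw [show c⁻¹ = Matrix.SpecialLinearGroup.toGL c'⁻¹ from
        (map_inv Matrix.SpecialLinearGroup.toGL c').symm,
        Matrix.SpecialLinearGroup.coe_GL_coe_matrix, Matrix.SpecialLinearGroup.coe_inv,
        Matrix.adjugate_fin_two]
      simp [c']
    have hsi : ((s⁻¹ : GL (Fin 2) R) : Matrix (Fin 2) (Fin 2) R) =
        !![(↑z⁻¹ : R), 0; 0, (↑z⁻¹ : R)] := by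
      rw [show s⁻¹ = Matrix.GeneralLinearGroup.scalar (Fin 2) z⁻¹ from (map_inv _ z).symm]
      ext i j
      fin_cases i <;> fin_cases j <;> simp [Matrix.GeneralLinearGroup.scalar]
    have hk : (((s * c)⁻¹ * g : GL (Fin 2) R) : Matrix (Fin 2) (Fin 2) R) =
        !![1, (↑z⁻¹ : R) * g 0 1; 0,
          (↑z⁻¹ : R) * (g 1 1 - (↑z⁻¹ : R) * g 1 0 * g 0 1)] := by
      rw [mul_inv_rev, Units.val_mul, Units.val_mul, hci, hsi]
      ext i j
      fin_cases i <;> fin_cases j <;>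
        simp [Matrix.mul_apply, Fin.sum_univ_two]
      · exact hz
      · linear_combination (-(↑z⁻¹ : R) * g 1 0) * hzz
      · ring
    change _ ∧ _ ∧ _ ∧ _
    rw [hk]
    simp only [Matrix.of_apply, Matrix.cons_val', Matrix.cons_val_zero,
      Matrix.cons_val_one, Matrix.cons_val_fin_one]
    refine ⟨by simp, Ideal.mul_mem_left _ _ hg.1, by simp, ?_⟩
    have := add_mem (Ideal.mul_mem_left _ (-(↑z⁻¹ : R)) hg.2)
      (Ideal.mul_mem_left _ (-(↑z⁻¹ : R) * ((↑z⁻¹ : R) * g 1 0)) (hle hg.1))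
    convert this using 1
    linear_combination hzz

/-- `Γ(ℓ) = Z₀ U₀ K_{m, m'}`, the set of products, as a subgroup of `GL(2, R)`. -/
def intGroup (R : Type*) [CommRing R] [IsLocalRing R] (ℓ : ℕ) : Subgroup (GL (Fin 2) R) :=
  (intGroupAux R ℓ).copy
    ((scalarSubgroup R : Set (GL (Fin 2) R)) * lowerUnipotent R * congrSubgroup R ℓ)
    (coe_intGroupAux ℓ)

theorem mem_intGroup {ℓ : ℕ} {g : GL (Fin 2) R} :
    g ∈ intGroup R ℓ ↔
      g 0 1 ∈ maxPow R (halfSucc ℓ) ∧ g 0 0 - g 1 1 ∈ maxPow R (halfCeil ℓ) := by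
  rw [intGroup, Subgroup.copy_eq]
  rfl

/-- `Γ'(ℓ) = Γ(ℓ) ∩ SL(2, R)`. -/
def intGroupSL (R : Type*) [CommRing R] [IsLocalRing R] (ℓ : ℕ) : Subgroup SL(2, R) :=
  (intGroup R ℓ).comap Matrix.SpecialLinearGroup.toGL

theorem mem_intGroupSL {ℓ : ℕ} {g : SL(2, R)} :
    g ∈ intGroupSL R ℓ ↔
      g 0 1 ∈ maxPow R (halfSucc ℓ) ∧ g 0 0 - g 1 1 ∈ maxPow R (halfCeil ℓ) :=
  mem_intGroup

theorem isUnit_apply_of_mem_intGroupSL {ℓ : ℕ} {g : SL(2, R)} (hg : g ∈ intGroupSL R ℓ) :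
    IsUnit (g 0 0) :=
  isUnit_apply_zero_zero (g := Matrix.SpecialLinearGroup.toGL g) (mem_intGroup.1 hg)

/-- The subgroup `(Rˣ)² (1 + P ^ k)` of `Rˣ`. -/
def squareClassSubgroup (R : Type*) [CommRing R] [IsLocalRing R] (k : ℕ) : Subgroup Rˣ :=
  (powMonoidHom 2 : Rˣ →* Rˣ).range ⊔
    (Units.map (Ideal.Quotient.mk (maxPow R k)).toMonoidHom).ker

/-- `S` is a set of representatives of `Rˣ / (Rˣ)² (1 + P ^ k)`: every unit is in a unique way a
product of an element of `S` and an element of `(Rˣ)² (1 + P ^ k)`. -/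
def IsSquareClassReps (R : Type*) [CommRing R] [IsLocalRing R] (k : ℕ) (S : Set Rˣ) : Prop :=
  Subgroup.IsComplement S (squareClassSubgroup R k : Set Rˣ)

end LocalRing

/-! ### Representations -/

/-- A cuspidal representation of `SL(2, k)`: it is irreducible and has no nonzero vector fixed by
the unipotent radical of the upper triangular Borel subgroup (all Borel subgroups are
conjugate to this one). -/
def IsCuspidal {k : Type*} [Field k] {V : Type*} [AddCommGroup V] [Module ℂ V]
    (σ : Representation ℂ SL(2, k) V) : Prop :=
  σ.IsIrreducible ∧
    ∀ v : V, (∀ x : k, σ ⟨!![1, x; 0, 1], by simp [Matrix.det_fin_two]⟩ v = v) → v = 0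

/-- The one-dimensional representation afforded by a complex character. -/
def charRep {H : Type*} [Group H] (χ : H →* ℂ) : Representation ℂ H ℂ where
  toFun h := χ h • LinearMap.id
  map_one' := by ext; simp
  map_mul' a b := by ext; simp [mul_comm]

/-- `Ind_H^G ρ`: the functions `f : G → W` with `f (h g) = ρ h (f g)`, on which `G` acts by right
translation. It is used below only for open subgroups `H` of finite index and for representations
`ρ` with open kernel, where every such `f` is locally constant. -/
noncomputable abbrev indRep {G : Type*} [Group G] (H : Subgroup G) {W : Type*} [AddCommGroup W]
    [Module ℂ W] (ρ : Representation ℂ H W) : Representation ℂ G (Representation.coindV H.subtype ρ) :=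
  Representation.coind H.subtype ρ

noncomputable section LocalField

/-- The inclusion of `SL(2, 𝒪)` in `GL(2, F)`. -/
def inclGL (F : Type*) [Field F] [ValuativeRel F] : SL(2, 𝒪[F]) →* GL (Fin 2) F :=
  Matrix.SpecialLinearGroup.toGL.comp (Matrix.SpecialLinearGroup.map (algebraMap 𝒪[F] F))

theorem inclGL_apply {F : Type*} [Field F] [ValuativeRel F] (g : SL(2, 𝒪[F])) (i j : Fin 2) :
    inclGL F g i j = (g i j : F) := rfl

theorem inclGL_injective (F : Type*) [Field F] [ValuativeRel F] :
    Function.Injective (inclGL F) := by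
  intro a b hab
  ext i j
  rw [← inclGL_apply, ← inclGL_apply, hab]

/-- The additive character `ψ` of `F` has conductor the maximal ideal `P`: it is trivial on `P`
but not on the ring of integers. -/
structure HasConductorMaximalIdeal {F : Type*} [Field F] [ValuativeRel F]
    (ψ : AddChar F ℂ) : Prop where
  trivial_on : ∀ x : 𝒪[F], x ∈ 𝓂[F] → ψ (x : F) = 1
  nontrivial : ∃ x : 𝒪[F], ψ (x : F) ≠ 1

variable {F : Type*} [Field F] [ValuativeRel F] [TopologicalSpace F]
  [IsNonarchimedeanLocalField F]

theorem mem_maxPow_iff {ϖ : 𝒪[F]} (hϖ : Irreducible ϖ) {n : ℕ} {x : 𝒪[F]} :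
    x ∈ maxPow 𝒪[F] n ↔ ϖ ^ n ∣ x := by
  rw [maxPow, hϖ.maximalIdeal_eq, Ideal.span_singleton_pow, Ideal.mem_span_singleton]

theorem coe_uniformizer_ne_zero {F : Type*} [Field F] [ValuativeRel F] {ϖ : 𝒪[F]} (hϖ : Irreducible ϖ) : (ϖ : F) ≠ 0 := by
  simpa using hϖ.ne_zero

/-- `g_ℓ = diag(ϖ ^ ℓ, 1)` in `GL(2, F)`. -/
def gEll {ϖ : 𝒪[F]} (hϖ : Irreducible ϖ) (ℓ : ℕ) : GL (Fin 2) F :=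
  Matrix.GeneralLinearGroup.mkOfDetNeZero !![(ϖ : F) ^ ℓ, 0; 0, 1]
    (by simpa [Matrix.det_fin_two] using fun h => absurd h hϖ.ne_zero)

theorem gEll_conj_mem_range {ϖ : 𝒪[F]} (hϖ : Irreducible ϖ) {ℓ : ℕ} {h : SL(2, 𝒪[F])}
    (hh : h ∈ lowerTriMod 𝒪[F] ℓ) :
    (gEll hϖ ℓ)⁻¹ * inclGL F h * gEll hϖ ℓ ∈ (inclGL F).range := by
  obtain ⟨b, hb⟩ := (mem_maxPow_iff hϖ).1 hh
  have hdet : h 0 0 * h 1 1 - h 0 1 * h 1 0 = 1 := by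
    rw [← Matrix.det_fin_two]; exact h.2
  refine ⟨⟨!![h 0 0, b; ϖ ^ ℓ * h 1 0, h 1 1], ?_⟩, ?_⟩
  · rw [Matrix.det_fin_two_of]
    linear_combination hdet + h 1 0 * hb
  · rw [mul_assoc, eq_inv_mul_iff_mul_eq]
    have hbF : ((h 0 1 : 𝒪[F]) : F) = (ϖ : F) ^ ℓ * (b : F) := by rw [hb]; simp
    apply Units.ext
    change !![(ϖ : F) ^ ℓ, 0; 0, 1] *
        (!![h 0 0, b; ϖ ^ ℓ * h 1 0, h 1 1].map fun x : 𝒪[F] => (x : F)) =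
      ((h : Matrix (Fin 2) (Fin 2) 𝒪[F]).map fun x : 𝒪[F] => (x : F)) *
        !![(ϖ : F) ^ ℓ, 0; 0, 1]
    ext i j
    fin_cases i <;> fin_cases j <;>
      simp [Matrix.mul_apply, Fin.sum_univ_two, hbF, mul_comm]

/-- The homomorphism `h ↦ g_ℓ⁻¹ h g_ℓ` from `B'_ℓ` to `SL(2, 𝒪)`. -/
def gEllConj {ϖ : 𝒪[F]} (hϖ : Irreducible ϖ) (ℓ : ℕ) : lowerTriMod 𝒪[F] ℓ →* SL(2, 𝒪[F]) where
  toFun h := (MonoidHom.ofInjective (inclGL_injective F)).symm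
    ⟨(gEll hϖ ℓ)⁻¹ * inclGL F h * gEll hϖ ℓ, gEll_conj_mem_range hϖ h.2⟩
  map_one' := by
    rw [MulEquiv.symm_apply_eq, map_one]
    ext1
    simp
  map_mul' a b := by
    rw [MulEquiv.symm_apply_eq, map_mul, MulEquiv.apply_symm_apply, MulEquiv.apply_symm_apply]
    ext1
    simp [mul_assoc]

theorem inclGL_gEllConj {ϖ : 𝒪[F]} (hϖ : Irreducible ϖ) (ℓ : ℕ) (h : lowerTriMod 𝒪[F] ℓ) :
    inclGL F (gEllConj hϖ ℓ h) = (gEll hϖ ℓ)⁻¹ * inclGL F h * gEll hϖ ℓ :=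
  MonoidHom.apply_ofInjective_symm (inclGL_injective F) _

/-- The representation `^{g_ℓ}σ` of `B'_ℓ`, `h ↦ σ (g_ℓ⁻¹ h g_ℓ)`, where `σ` is inflated to
`SL(2, 𝒪)` through reduction modulo `P`. -/
def twistedRep {ϖ : 𝒪[F]} (hϖ : Irreducible ϖ) {V : Type*} [AddCommGroup V] [Module ℂ V]
    (σ : Representation ℂ SL(2, 𝓀[F]) V) (ℓ : ℕ) :
    Representation ℂ (lowerTriMod 𝒪[F] ℓ) V :=
  (σ.comp (Matrix.SpecialLinearGroup.map (IsLocalRing.residue 𝒪[F]))).comp (gEllConj hϖ ℓ)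

/-- The Mackey component `σ(ℓ)`, induced from `B'_ℓ` to `SL(2, 𝒪)` from `^{g_ℓ}σ`. -/
abbrev mackeyComponent {ϖ : 𝒪[F]} (hϖ : Irreducible ϖ) {V : Type*} [AddCommGroup V] [Module ℂ V]
    (σ : Representation ℂ SL(2, 𝓀[F]) V) (ℓ : ℕ) :=
  indRep (lowerTriMod 𝒪[F] ℓ) (twistedRep hϖ σ ℓ)

/-- The argument `u ϖ^{-ℓ} g₁₁⁻¹ g₁₂` of `ψ` in the character defining `I(1, u, ℓ)`. -/
def etaArg (ϖ : 𝒪[F]) (u : 𝒪[F]ˣ) (ℓ : ℕ) (g : SL(2, 𝒪[F])) : F :=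
  ((u : 𝒪[F]) : F) * ((ϖ : F) ^ ℓ)⁻¹ * ((g 0 0 : 𝒪[F]) : F)⁻¹ * ((g 0 1 : 𝒪[F]) : F)

theorem etaArg_mul {ϖ : 𝒪[F]} (hϖ : Irreducible ϖ) (u : 𝒪[F]ˣ) {ℓ : ℕ} {g h : SL(2, 𝒪[F])}
    (hg : g ∈ intGroupSL 𝒪[F] ℓ) (hh : h ∈ intGroupSL 𝒪[F] ℓ) :
    ∃ x : 𝒪[F], x ∈ 𝓂[F] ∧ etaArg ϖ u ℓ (g * h) = etaArg ϖ u ℓ g + etaArg ϖ u ℓ h + x := by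
  obtain ⟨A, hA⟩ := isUnit_apply_of_mem_intGroupSL hg
  obtain ⟨a, ha⟩ := isUnit_apply_of_mem_intGroupSL hh
  obtain ⟨c, hc⟩ := isUnit_apply_of_mem_intGroupSL (mul_mem hg hh)
  obtain ⟨hg1, hg2⟩ := mem_intGroupSL.1 hg
  obtain ⟨hh1, hh2⟩ := mem_intGroupSL.1 hh
  have hle := maxPow_halfSucc_le (R := 𝒪[F]) ℓ
  have hsum : halfSucc ℓ + halfCeil ℓ = ℓ + 1 := by
    unfold halfCeil halfSucc; omega
  have key : g 0 1 * (h 0 0 * (g 0 0 * (h 1 1 - h 0 0)) - g 0 1 * h 1 0 * h 0 0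
      - g 0 0 * h 0 1 * h 1 0) ∈ maxPow 𝒪[F] (ℓ + 1) := by
    rw [maxPow, ← hsum, pow_add]
    refine Ideal.mul_mem_mul hg1 (sub_mem (sub_mem ?_ ?_) ?_)
    · refine Ideal.mul_mem_left _ _ (Ideal.mul_mem_left _ _ ?_)
      have := neg_mem hh2
      rwa [neg_sub] at this
    · exact Ideal.mul_mem_right _ _ (Ideal.mul_mem_right _ _ (hle hg1))
    · exact Ideal.mul_mem_right _ _ (Ideal.mul_mem_left _ _ (hle hh1))
  obtain ⟨r, hr⟩ := (mem_maxPow_iff hϖ).1 key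
  refine ⟨ϖ * (r * u * ↑A⁻¹ * ↑a⁻¹ * ↑c⁻¹), Ideal.mul_mem_right _ _ ?_, ?_⟩
  · rw [hϖ.maximalIdeal_eq]; exact Ideal.mem_span_singleton_self _
  have hm0 : (g * h) 0 0 = g 0 0 * h 0 0 + g 0 1 * h 1 0 := by
    simp [Matrix.mul_apply, Fin.sum_univ_two]
  have hm1 : (g * h) 0 1 = g 0 0 * h 0 1 + g 0 1 * h 1 1 := by
    simp [Matrix.mul_apply, Fin.sum_univ_two]
  have hAi : ((↑A⁻¹ : 𝒪[F]) : F) = ((g 0 0 : 𝒪[F]) : F)⁻¹ := by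
    rw [← hA]; exact eq_inv_of_mul_eq_one_left (by exact_mod_cast A.inv_mul)
  have hai : ((↑a⁻¹ : 𝒪[F]) : F) = ((h 0 0 : 𝒪[F]) : F)⁻¹ := by
    rw [← ha]; exact eq_inv_of_mul_eq_one_left (by exact_mod_cast a.inv_mul)
  have hci : ((↑c⁻¹ : 𝒪[F]) : F) = (((g * h) 0 0 : 𝒪[F]) : F)⁻¹ := by
    rw [← hc]; exact eq_inv_of_mul_eq_one_left (by exact_mod_cast c.inv_mul)
  have hA0 : ((g 0 0 : 𝒪[F]) : F) ≠ 0 := by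
    rw [← hA]; simp
  have ha0 : ((h 0 0 : 𝒪[F]) : F) ≠ 0 := by
    rw [← ha]; simp
  have hc0 : (((g * h) 0 0 : 𝒪[F]) : F) ≠ 0 := by
    rw [← hc]; simp
  have hp := coe_uniformizer_ne_zero hϖ
  have hrF := congrArg (Subtype.val : 𝒪[F] → F) hr
  have hm0F := congrArg (Subtype.val : 𝒪[F] → F) hm0
  have hm1F := congrArg (Subtype.val : 𝒪[F] → F) hm1
  push_cast at hrF hm0F hm1F ⊢
  simp only [etaArg]
  rw [hAi, hai, hci, hm1F]
  rw [hm0F] at hc0 ⊢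
  field_simp
  rw [pow_succ] at hrF
  linear_combination hrF

/-- The character `g ↦ ψ(u ϖ^{-ℓ} g₁₁⁻¹ g₁₂)` of `Γ'(ℓ)`. -/
def etaHat {ϖ : 𝒪[F]} (hϖ : Irreducible ϖ) {ψ : AddChar F ℂ} (hψ : HasConductorMaximalIdeal ψ)
    (u : 𝒪[F]ˣ) (ℓ : ℕ) : intGroupSL 𝒪[F] ℓ →* ℂ where
  toFun g := ψ (etaArg ϖ u ℓ g)
  map_one' := by simp [etaArg]
  map_mul' g h := by
    obtain ⟨x, hx, hxe⟩ := etaArg_mul hϖ u g.2 h.2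
    have := congrArg ψ hxe
    rw [AddChar.map_add_eq_mul, AddChar.map_add_eq_mul, hψ.trivial_on x hx, mul_one] at this
    exact this

/-- The representation `I(1, u, ℓ)` of `SL(2, 𝒪)`, induced from the character `etaHat` of
`Γ'(ℓ)`. -/
abbrev repI {ϖ : 𝒪[F]} (hϖ : Irreducible ϖ) {ψ : AddChar F ℂ} (hψ : HasConductorMaximalIdeal ψ)
    (u : 𝒪[F]ˣ) (ℓ : ℕ) :=
  indRep (intGroupSL 𝒪[F] ℓ) (charRep (etaHat hϖ hψ u ℓ))

end LocalField

/-! Two computations carry the theorem. The first concerns the characters η_u : g ↦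
ψ(uϖ^{-ℓ}g₁₁⁻¹g₁₂) of Γ'(ℓ). If k intertwines η_{u'} and η_u, conjugating lower unipotents by k
forces k₁₂ ∈ P^{m'} (`mem_lowerTriMod_of_intertwines`), and conjugating upper unipotents forces
u'k₁₁² ≡ u mod P^m (`sq_mul_sub_mem_of_intertwines`). For representatives of the square classes this
leaves only u = u' and k ∈ Γ'(ℓ). Since the characters are trivial on a common normal subgroup of
finite index, averaging shows that a stable subspace of ⊕ I(1,u,ℓ) contains the canonical generator
of every summand to which it projects nontrivially (`lof_charPoint_mem`). Irreducibility follows,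
and so does injectivity of any intertwining map that kills none of these generators.

The second produces explicit vectors in σ(ℓ). If the upper unipotent group acts on w through x ↦
ψ(ux), the function `kirillovVec` attached to u and w lies in σ(ℓ), and Γ'(ℓ) acts on it through
η_u: the slope g₁₁⁻¹g₁₂ is additive modulo P^{ℓ+1}, and in residual characteristic 2 the congruence
h₁₁² ≡ 1 mod P gives h₁₁ ≡ 1, so the diagonal factor disappears. A nonzero w exists for every u,
because all elements of a finite field of characteristic 2 are squares. Frobenius reciprocity then
embeds ⊕ I(1,u,ℓ) in σ(ℓ).

Surjectivity needs no dimension count. Diagonal translations change u by squares, so uniqueness of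
Whittaker vectors (`exists_smul_eq_of_mem_whittaker`, by Gelfand's anti-involution argument) puts
the vectors of all units in the image. Summing over the lifts modulo P^m of a residue class leaves a
function supported on B'_ℓ (`sum_kirillovVec`). Such functions generate σ(ℓ), as a cuspidal σ is
spanned by its Whittaker vectors. -/

/-! ### Unipotent and diagonal elements of `SL(2, R)` -/

section Elements

variable {R : Type*} [CommRing R]

/-- The upper triangular unipotent matrix with upper right entry `x`. -/
def upperUnip (x : R) : SL(2, R) := ⟨!![1, x; 0, 1], by simp [Matrix.det_fin_two]⟩

/-- The diagonal matrix with entries `a` and `a⁻¹`. -/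
def diagSL (a : Rˣ) : SL(2, R) :=
  ⟨!![(a : R), 0; 0, ((a⁻¹ : Rˣ) : R)], by simp [Matrix.det_fin_two]⟩

/-- The lower triangular unipotent matrix with lower left entry `y`. -/
def lowerUnip (y : R) : SL(2, R) := ⟨!![1, 0; y, 1], by simp [Matrix.det_fin_two]⟩

@[simp] theorem upperUnip_zero_zero (x : R) : upperUnip x 0 0 = 1 := rfl
@[simp] theorem upperUnip_zero_one (x : R) : upperUnip x 0 1 = x := rfl
@[simp] theorem upperUnip_one_zero (x : R) : upperUnip x 1 0 = 0 := rfl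
@[simp] theorem upperUnip_one_one (x : R) : upperUnip x 1 1 = 1 := rfl
@[simp] theorem diagSL_zero_zero (a : Rˣ) : diagSL a 0 0 = a := rfl
@[simp] theorem diagSL_zero_one (a : Rˣ) : diagSL a 0 1 = 0 := rfl
@[simp] theorem diagSL_one_zero (a : Rˣ) : diagSL a 1 0 = 0 := rfl
@[simp] theorem diagSL_one_one (a : Rˣ) : diagSL a 1 1 = ((a⁻¹ : Rˣ) : R) := rfl
@[simp] theorem lowerUnip_zero_zero (x : R) : lowerUnip x 0 0 = 1 := rfl
@[simp] theorem lowerUnip_zero_one (x : R) : lowerUnip x 0 1 = 0 := rfl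
@[simp] theorem lowerUnip_one_zero (x : R) : lowerUnip x 1 0 = x := rfl
@[simp] theorem lowerUnip_one_one (x : R) : lowerUnip x 1 1 = 1 := rfl

theorem SL2_mul_zero_zero (g h : SL(2, R)) : (g * h) 0 0 = g 0 0 * h 0 0 + g 0 1 * h 1 0 := by
  simp [Matrix.mul_apply, Fin.sum_univ_two]

theorem SL2_mul_zero_one (g h : SL(2, R)) : (g * h) 0 1 = g 0 0 * h 0 1 + g 0 1 * h 1 1 := by
  simp [Matrix.mul_apply, Fin.sum_univ_two]

theorem SL2_mul_one_zero (g h : SL(2, R)) : (g * h) 1 0 = g 1 0 * h 0 0 + g 1 1 * h 1 0 := by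
  simp [Matrix.mul_apply, Fin.sum_univ_two]

theorem SL2_mul_one_one (g h : SL(2, R)) : (g * h) 1 1 = g 1 0 * h 0 1 + g 1 1 * h 1 1 := by
  simp [Matrix.mul_apply, Fin.sum_univ_two]

theorem SL2_det (g : SL(2, R)) : g 0 0 * g 1 1 - g 0 1 * g 1 0 = 1 := by
  rw [← Matrix.det_fin_two]; exact g.2

theorem SL2_ext {g h : SL(2, R)} (h00 : g 0 0 = h 0 0) (h01 : g 0 1 = h 0 1)
    (h10 : g 1 0 = h 1 0) (h11 : g 1 1 = h 1 1) : g = h := by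
  ext i j
  fin_cases i <;> fin_cases j <;> assumption

theorem upperUnip_zero : upperUnip (0 : R) = 1 := by
  apply SL2_ext <;> simp

theorem upperUnip_add (x y : R) : upperUnip (x + y) = upperUnip x * upperUnip y := by
  apply SL2_ext <;>
    simp [SL2_mul_zero_zero, SL2_mul_zero_one, SL2_mul_one_zero, SL2_mul_one_one, add_comm]

theorem diagSL_mul (a b : Rˣ) : diagSL (a * b) = diagSL a * diagSL b := by
  apply SL2_ext <;>
    simp [SL2_mul_zero_zero, SL2_mul_zero_one, SL2_mul_one_zero, SL2_mul_one_one, mul_comm]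

theorem diagSL_mul_upperUnip (a : Rˣ) (x : R) :
    diagSL a * upperUnip x = upperUnip ((a : R) ^ 2 * x) * diagSL a := by
  apply SL2_ext <;>
    simp only [SL2_mul_zero_zero, SL2_mul_zero_one, SL2_mul_one_zero, SL2_mul_one_one,
      upperUnip_zero_zero, upperUnip_zero_one, upperUnip_one_zero, upperUnip_one_one,
      diagSL_zero_zero, diagSL_zero_one, diagSL_one_zero, diagSL_one_one]
  · ring
  · linear_combination (-(a : R) * x) * a.mul_inv
  · ring
  · ring

variable {S : Type*} [CommRing S]

theorem map_SL2_apply (f : R →+* S) (g : SL(2, R)) (i j : Fin 2) :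
    Matrix.SpecialLinearGroup.map f g i j = f (g i j) := rfl

end Elements

/-! ### Whittaker vectors of representations of `SL(2, k)`, `k` a finite field -/

section Whittaker

variable {k : Type*} [Field k] {V : Type*} [AddCommGroup V] [Module ℂ V]
  (σ : Representation ℂ SL(2, k) V) (ψ : AddChar k ℂ)

/-- The vectors on which the upper unipotent group acts through `ψ`. -/
def whittaker : Submodule ℂ V where
  carrier := {v | ∀ x, σ (upperUnip x) v = ψ x • v}
  add_mem' := by
    intro v w hv hw x
    rw [map_add, hv x, hw x, smul_add]
  zero_mem' := by simp
  smul_mem' := by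
    intro c v hv x
    rw [map_smul, hv x, smul_comm]

variable {σ ψ}

theorem mem_whittaker {v : V} : v ∈ whittaker σ ψ ↔ ∀ x, σ (upperUnip x) v = ψ x • v := Iff.rfl

/-- A diagonal matrix permutes the spaces of Whittaker vectors. -/
theorem diagSL_mem_whittaker {c : k} {v : V} (hv : v ∈ whittaker σ (ψ.mulShift c)) (a : kˣ) :
    σ (diagSL a) v ∈ whittaker σ (ψ.mulShift (c * ((a⁻¹ : kˣ) : k) ^ 2)) := by
  intro x
  have h := diagSL_mul_upperUnip a (((a⁻¹ : kˣ) : k) ^ 2 * x)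
  have h2 : (a : k) ^ 2 * (((a⁻¹ : kˣ) : k) ^ 2 * x) = x := by
    rw [← mul_assoc, ← mul_pow, a.mul_inv, one_pow, one_mul]
  rw [h2] at h
  rw [← Module.End.mul_apply, ← map_mul, ← h, map_mul, Module.End.mul_apply, hv, map_smul]
  simp only [AddChar.mulShift_apply, mul_assoc]

variable [Fintype k]

variable (σ ψ) in
/-- The projection to the space of Whittaker vectors. -/
noncomputable def whittakerProj : Module.End ℂ V :=
  (Fintype.card k : ℂ)⁻¹ • ∑ x, ψ (-x) • σ (upperUnip x)

theorem apply_mul_whittakerProj (y : k) :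
    σ (upperUnip y) * whittakerProj σ ψ = ψ y • whittakerProj σ ψ := by
  rw [whittakerProj, mul_smul_comm, smul_comm (ψ y)]
  congr 1
  rw [Finset.mul_sum, Finset.smul_sum]
  refine Fintype.sum_equiv (Equiv.addLeft y) _ _ fun x => ?_
  rw [mul_smul_comm, ← map_mul, ← upperUnip_add, smul_smul, ← AddChar.map_add_eq_mul]
  congr 2
  simp

theorem whittakerProj_mul_apply (y : k) :
    whittakerProj σ ψ * σ (upperUnip y) = ψ y • whittakerProj σ ψ := by
  rw [whittakerProj, smul_mul_assoc, smul_comm (ψ y)]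
  congr 1
  rw [Finset.sum_mul, Finset.smul_sum]
  refine Fintype.sum_equiv (Equiv.addRight y) _ _ fun x => ?_
  rw [smul_mul_assoc, ← map_mul, ← upperUnip_add, smul_smul, ← AddChar.map_add_eq_mul]
  congr 2
  simp

theorem whittakerProj_mem (v : V) : whittakerProj σ ψ v ∈ whittaker σ ψ := fun y => by
  rw [← Module.End.mul_apply, apply_mul_whittakerProj]; rfl

theorem whittakerProj_of_mem {v : V} (hv : v ∈ whittaker σ ψ) : whittakerProj σ ψ v = v := by
  have h : ∀ x : k, (ψ (-x) • σ (upperUnip x)) v = v := fun x => by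
    rw [LinearMap.smul_apply, hv x, smul_smul, ← AddChar.map_add_eq_mul]; simp
  rw [whittakerProj, LinearMap.smul_apply, LinearMap.sum_apply, Finset.sum_congr rfl fun x _ => h x]
  rw [Finset.sum_const, Finset.card_univ, ← Nat.cast_smul_eq_nsmul ℂ, smul_smul,
    inv_mul_cancel₀ (by simp), one_smul]

/-! ### The commutative Hecke algebra of the Gelfand–Graev representation -/

variable (σ ψ) in
/-- The operator `e σ(g) e`, with `e` the projection to the space of Whittaker vectors. -/
noncomputable def whittakerOp (g : SL(2, k)) : Module.End ℂ V :=
  whittakerProj σ ψ * σ g * whittakerProj σ ψ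

theorem whittakerOp_upperUnip_mul (x : k) (g : SL(2, k)) :
    whittakerOp σ ψ (upperUnip x * g) = ψ x • whittakerOp σ ψ g := by
  rw [whittakerOp, map_mul, ← mul_assoc, whittakerProj_mul_apply, smul_mul_assoc, smul_mul_assoc]
  rfl

theorem whittakerOp_mul_upperUnip (x : k) (g : SL(2, k)) :
    whittakerOp σ ψ (g * upperUnip x) = ψ x • whittakerOp σ ψ g := by
  rw [whittakerOp, map_mul, mul_assoc, mul_assoc, apply_mul_whittakerProj, mul_smul_comm,
    mul_smul_comm]
  rfl

/-- Expanding the middle projection writes a product as an average of the operators attached to g n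
h, n unipotent. An anti-involution fixing each n can then be applied inside the sum. -/
theorem whittakerOp_mul (g h : SL(2, k)) : whittakerOp σ ψ g * whittakerOp σ ψ h =
    (Fintype.card k : ℂ)⁻¹ • ∑ x, ψ (-x) • whittakerOp σ ψ (g * upperUnip x * h) := by
  have hee : whittakerProj σ ψ * whittakerProj σ ψ = whittakerProj σ ψ :=
    LinearMap.ext fun v => whittakerProj_of_mem (whittakerProj_mem v)
  have : whittakerOp σ ψ g * whittakerOp σ ψ h =
      whittakerProj σ ψ * σ g * whittakerProj σ ψ * (σ h * whittakerProj σ ψ) := by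
    simp only [whittakerOp, mul_assoc]
    rw [← mul_assoc (whittakerProj σ ψ) (whittakerProj σ ψ), hee]
  rw [this]
  conv_lhs => enter [1, 2]; rw [whittakerProj]
  rw [mul_smul_comm, smul_mul_assoc, Finset.mul_sum, Finset.sum_mul]
  congr 1
  refine Finset.sum_congr rfl fun x _ => ?_
  rw [mul_smul_comm, smul_mul_assoc, whittakerOp, map_mul, map_mul]
  simp only [mul_assoc]

/-- The anti-involution of `SL(2, R)` that exchanges the diagonal entries. -/
def swapDiag {R : Type*} [CommRing R] (g : SL(2, R)) : SL(2, R) :=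
  ⟨!![g 1 1, g 0 1; g 1 0, g 0 0], by
    rw [Matrix.det_fin_two_of]; linear_combination SL2_det g⟩

theorem swapDiag_mul {R : Type*} [CommRing R] (g h : SL(2, R)) :
    swapDiag (g * h) = swapDiag h * swapDiag g := by
  apply SL2_ext <;>
    simp only [SL2_mul_zero_zero, SL2_mul_zero_one, SL2_mul_one_zero, SL2_mul_one_one] <;>
    simp [swapDiag, Matrix.mul_apply, Fin.sum_univ_two] <;> ring

theorem swapDiag_upperUnip {R : Type*} [CommRing R] (x : R) :
    swapDiag (upperUnip x) = upperUnip x := rfl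

/-- With a = g₁₁, moving `upperUnip x` across g turns x into a²x. Hence the operator is scaled by
both ψ(x) and ψ(a²x), and distinct diagonal entries give a² ≠ 1, so these differ for a suitable x.
-/
theorem whittakerOp_eq_zero (hψ : ψ ≠ 1) {g : SL(2, k)} (hg : g 1 0 = 0) (hg2 : g 0 0 ≠ g 1 1) :
    whittakerOp σ ψ g = 0 := by
  have hdet := SL2_det g
  rw [hg, mul_zero, sub_zero] at hdet
  have hne : g 0 0 ^ 2 - 1 ≠ 0 := by
    intro h
    have h0 : g 0 0 ≠ 0 := left_ne_zero_of_mul_eq_one hdet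
    apply hg2
    apply mul_left_cancel₀ h0
    linear_combination h - hdet
  obtain ⟨y, hy⟩ := AddChar.ne_one_iff.1 hψ
  obtain ⟨x, rfl⟩ : ∃ x, (g 0 0 ^ 2 - 1) * x = y := ⟨(g 0 0 ^ 2 - 1)⁻¹ * y, by field_simp⟩
  have h1 : g * upperUnip x = upperUnip (g 0 0 ^ 2 * x) * g := by
    apply SL2_ext <;>
      simp [SL2_mul_zero_zero, SL2_mul_zero_one, SL2_mul_one_zero, SL2_mul_one_one, hg]
    linear_combination (-g 0 0 * x) * hdet
  have h2 : ψ x • whittakerOp σ ψ g = ψ (g 0 0 ^ 2 * x) • whittakerOp σ ψ g := by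
    rw [← whittakerOp_mul_upperUnip, h1, whittakerOp_upperUnip_mul]
  rw [show g 0 0 ^ 2 * x = (g 0 0 ^ 2 - 1) * x + x by ring, AddChar.map_add_eq_mul, mul_comm,
    mul_smul, ← sub_eq_zero, ← smul_sub] at h2
  have h3 := (smul_eq_zero.1 h2).resolve_left (ψ.val_isUnit x).ne_zero
  rw [sub_eq_zero, eq_comm, ← sub_eq_zero] at h3
  nth_rw 2 [← one_smul ℂ (whittakerOp σ ψ g)] at h3
  rw [← sub_smul] at h3
  exact (smul_eq_zero.1 h3).resolve_left (sub_ne_zero.2 hy)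

/-- When g₂₁ ≠ 0, g and its image are conjugate by one unipotent element, whose two factors ψ(x)
cancel. When g₂₁ = 0, either g is fixed or both operators vanish. -/
theorem whittakerOp_swapDiag (hψ : ψ ≠ 1) (g : SL(2, k)) :
    whittakerOp σ ψ (swapDiag g) = whittakerOp σ ψ g := by
  by_cases hc : g 1 0 = 0
  · by_cases had : g 0 0 = g 1 1
    · congr 1
      apply SL2_ext <;> simp [swapDiag, had]
    · rw [whittakerOp_eq_zero hψ hc had, whittakerOp_eq_zero hψ (by simpa [swapDiag] using hc)
        (by simpa [swapDiag] using Ne.symm had)]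
  · set x := (g 1 1 - g 0 0) / g 1 0 with hx
    have hx' : x * g 1 0 = g 1 1 - g 0 0 := by rw [hx]; field_simp
    have h : swapDiag g * upperUnip x = upperUnip x * g := by
      apply SL2_ext <;>
        simp only [SL2_mul_zero_zero, SL2_mul_zero_one, SL2_mul_one_zero, SL2_mul_one_one] <;>
        simp [swapDiag]
      · linear_combination -hx'
      · ring
      · linear_combination hx'
    have h2 : ψ x • whittakerOp σ ψ (swapDiag g) = ψ x • whittakerOp σ ψ g := by
      rw [← whittakerOp_mul_upperUnip, h, whittakerOp_upperUnip_mul]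
    exact smul_right_injective _ (ψ.val_isUnit x).ne_zero h2

theorem whittakerOp_commute (hψ : ψ ≠ 1) (g h : SL(2, k)) :
    Commute (whittakerOp σ ψ g) (whittakerOp σ ψ h) := by
  rw [Commute, SemiconjBy, whittakerOp_mul]
  conv_rhs => rw [← whittakerOp_swapDiag hψ g, ← whittakerOp_swapDiag hψ h, whittakerOp_mul]
  congr 1
  refine Finset.sum_congr rfl fun x _ => ?_
  rw [← whittakerOp_swapDiag hψ, swapDiag_mul, swapDiag_mul, swapDiag_upperUnip, mul_assoc]

/-- The translates of a nonzero vector span an irreducible representation. -/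
theorem span_orbit_eq_top {G W : Type*} [Group G] [AddCommGroup W] [Module ℂ W]
    {ρ : Representation ℂ G W} (hρ : ρ.IsIrreducible) {v : W} (hv : v ≠ 0) :
    Submodule.span ℂ (Set.range fun g => ρ g v) = ⊤ := by
  let T : Subrepresentation ρ := ⟨Submodule.span ℂ (Set.range fun g => ρ g v), by
    intro g w hw
    induction hw using Submodule.span_induction with
    | mem x hx =>
      obtain ⟨h, rfl⟩ := hx
      exact Submodule.subset_span ⟨g * h, by simp⟩
    | zero => simp
    | add x y _ _ hx hy => rw [map_add]; exact add_mem hx hy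
    | smul c x _ hx => rw [map_smul]; exact Submodule.smul_mem _ _ hx⟩
  have hvT : v ∈ T.toSubmodule := Submodule.subset_span ⟨1, by simp⟩
  rcases hρ.eq_bot_or_eq_top T with h | h
  · rw [h] at hvT
    exact absurd ((Submodule.mem_bot ℂ).1 hvT) hv
  · exact congrArg Subrepresentation.toSubmodule h

theorem finiteDimensional_of_isIrreducible {G W : Type*} [Group G] [Finite G] [AddCommGroup W]
    [Module ℂ W] {ρ : Representation ℂ G W} (hρ : ρ.IsIrreducible) : FiniteDimensional ℂ W := by
  by_cases h : ∃ v : W, v ≠ 0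
  · obtain ⟨v, hv⟩ := h
    exact ⟨Submodule.fg_def.2 ⟨_, Set.finite_range _, span_orbit_eq_top hρ hv⟩⟩
  · push Not at h
    have : Subsingleton W := ⟨fun a b => by rw [h a, h b]⟩
    infer_instance

/-- Multiplicity one for Whittaker vectors. -/
theorem exists_smul_eq_of_mem_whittaker (hσ : σ.IsIrreducible) (hψ : ψ ≠ 1) {v w : V}
    (hv : v ∈ whittaker σ ψ) (hv0 : v ≠ 0) (hw : w ∈ whittaker σ ψ) : ∃ c : ℂ, c • v = w := by
  have hfin := finiteDimensional_of_isIrreducible hσ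
  have hspan : ∀ {v : V}, v ∈ whittaker σ ψ → v ≠ 0 → ∀ {w : V}, w ∈ whittaker σ ψ →
      w ∈ Submodule.span ℂ (Set.range fun g => whittakerOp σ ψ g v) := by
    intro v hv hv0 w hw
    have h := Submodule.mem_map_of_mem (f := whittakerProj σ ψ)
      (show w ∈ Submodule.span ℂ (Set.range fun g => σ g v) by
        rw [span_orbit_eq_top hσ hv0]; trivial)
    rw [whittakerProj_of_mem hw, Submodule.map_span, ← Set.range_comp] at h
    convert h using 3
    ext g
    simp [whittakerOp, whittakerProj_of_mem hv]
  -- An eigenvector e of one operator generates the whole Whittaker space under the others; as all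
  -- of them commute, the eigenvalue holds everywhere.
  have hscalar : ∀ g, ∃ μ : ℂ, ∀ w ∈ whittaker σ ψ, whittakerOp σ ψ g w = μ • w := by
    intro g
    have : Nontrivial (whittaker σ ψ) := ⟨⟨v, hv⟩, 0, fun h => hv0 (congrArg Subtype.val h)⟩
    obtain ⟨μ, hμ⟩ := Module.End.exists_eigenvalue
      ((whittakerOp σ ψ g).restrict (p := whittaker σ ψ) (q := whittaker σ ψ)
        fun w _ => whittakerProj_mem _)
    obtain ⟨⟨e, he⟩, he1, he0⟩ := hμ.exists_hasEigenvector
    have he2 : whittakerOp σ ψ g e = μ • e :=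
      congrArg Subtype.val (Module.End.mem_eigenspace_iff.1 he1)
    refine ⟨μ, fun w hw => ?_⟩
    have := hspan he (fun h => he0 (Subtype.ext h)) hw
    clear hw
    induction this using Submodule.span_induction with
    | mem x hx =>
      obtain ⟨h, rfl⟩ := hx
      change (whittakerOp σ ψ g * whittakerOp σ ψ h) e = μ • whittakerOp σ ψ h e
      rw [(whittakerOp_commute hψ g h).eq, Module.End.mul_apply, he2, map_smul]
    | zero => simp
    | add x y _ _ hx hy => rw [map_add, hx, hy, smul_add]
    | smul c x _ hx => rw [map_smul, hx, smul_comm]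
  choose μ hμ using hscalar
  have := hspan hv hv0 hw
  rw [← Submodule.mem_span_singleton]
  refine Submodule.span_le.2 ?_ this
  rintro _ ⟨g, rfl⟩
  change whittakerOp σ ψ g v ∈ _
  rw [hμ g v hv]
  exact Submodule.smul_mem _ _ (Submodule.mem_span_singleton_self v)

/-- A cuspidal representation is spanned by its Whittaker vectors. -/
theorem iSup_whittaker_eq_top (hσ : IsCuspidal σ) (hψ : ψ ≠ 1) :
    ⨆ a : kˣ, whittaker σ (ψ.mulShift a) = ⊤ := by
  classical
  rw [eq_top_iff]
  intro v _
  have hp := AddChar.IsPrimitive.of_ne_one hψ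
  -- Fourier inversion on the unipotent group: the sum over all characters concentrates at x = 0.
  -- Cuspidality then removes the term of the trivial character.
  have key : ∑ a : k, whittakerProj σ (ψ.mulShift a) v = v := by
    simp only [whittakerProj, LinearMap.smul_apply, LinearMap.sum_apply, ← Finset.smul_sum]
    rw [Finset.sum_comm]
    simp only [← Finset.sum_smul, AddChar.mulShift_apply, AddChar.sum_mulShift _ hp]
    rw [Finset.sum_eq_single (0 : k)]
    · rw [neg_zero, if_pos rfl, upperUnip_zero, map_one, smul_smul,
        inv_mul_cancel₀ (by simp)]
      simp
    · intro x _ hx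
      simp [hx]
    · simp
  rw [← key]
  refine Submodule.sum_mem _ fun a _ => ?_
  by_cases ha : a = 0
  · have h0 : whittakerProj σ (ψ.mulShift a) v = 0 := by
      refine hσ.2 _ fun x => ?_
      have := whittakerProj_mem (σ := σ) (ψ := ψ.mulShift a) v x
      rw [ha, AddChar.mulShift_apply, zero_mul, AddChar.map_zero_eq_one, one_smul] at this
      rw [ha]
      exact this
    rw [h0]
    exact zero_mem _
  · exact Submodule.mem_iSup_of_mem (Units.mk0 a ha) (whittakerProj_mem v)

/-- In characteristic two every nontrivial character occurs in a cuspidal representation. -/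
theorem exists_mem_whittaker_ne_zero [CharP k 2] (hσ : IsCuspidal σ) (hψ : ψ ≠ 1) (a : kˣ) :
    ∃ v ∈ whittaker σ (ψ.mulShift a), v ≠ 0 := by
  have hnt : ∃ b : kˣ, whittaker σ (ψ.mulShift b) ≠ ⊥ := by
    by_contra! h
    have h1 := iSup_whittaker_eq_top hσ hψ
    simp only [h, iSup_bot] at h1
    obtain ⟨T, T', hT⟩ := hσ.1.exists_pair_ne
    refine hT (Subrepresentation.toSubmodule_injective ?_)
    rw [← inf_top_eq T.toSubmodule, ← inf_top_eq T'.toSubmodule, ← h1, inf_bot_eq, inf_bot_eq]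
  obtain ⟨b, hb⟩ := hnt
  obtain ⟨v, hv, hv0⟩ := (Submodule.ne_bot_iff _).1 hb
  -- The diagonal matrix of s divides the index b by s², so a square root of b/a carries b to a.
  obtain ⟨s, hs⟩ := FiniteField.isSquare_of_char_two
    (CharP.ringChar_of_prime_eq_zero Nat.prime_two (CharP.cast_eq_zero k 2))
    ((b / a : kˣ) : k)
  have hs0 : s ≠ 0 := by
    rintro rfl
    simp at hs
  refine ⟨σ (diagSL (Units.mk0 s hs0)) v, ?_, fun h => hv0 ?_⟩
  · convert diagSL_mem_whittaker hv (Units.mk0 s hs0) using 2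
    have h1 : (b : k) = s * s * a := by rw [← hs]; simp
    rw [h1]
    simp
    field_simp
  · rw [← σ.inv_self_apply (diagSL (Units.mk0 s hs0)) v, h, map_zero]

end Whittaker

/-! ### Induced representations -/

section Induced

variable {G : Type*} [Group G] {H : Subgroup G}

theorem apply_out_eq {X : Type*} {k : G → X} (hk : ∀ g, ∀ h ∈ H, k (g * h) = k g) (g : G) :
    k (g : G ⧸ H).out = k g := by
  obtain ⟨h, hh⟩ := QuotientGroup.mk_out_eq_mul H g
  rw [hh, hk _ _ h.2]

section Point

variable {W : Type*} [AddCommGroup W] [Module ℂ W] (ρ : Representation ℂ H W)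

theorem indRep_apply (g x : G) (f : Representation.coindV H.subtype ρ) :
    (indRep H ρ g f).1 x = f.1 (x * g) := rfl

variable {ρ} in
theorem coindV_apply_mul (f : Representation.coindV H.subtype ρ) {h : G} (hh : h ∈ H) (x : G) :
    f.1 (h * x) = ρ ⟨h, hh⟩ (f.1 x) := f.2 ⟨h, hh⟩ x

open Classical in
/-- The element of `Ind_H^G ρ` that is supported on `H` and takes the value `w` at `1`. -/
noncomputable def indPoint (w : W) : Representation.coindV H.subtype ρ :=
  ⟨fun g => if hg : g ∈ H then ρ ⟨g, hg⟩ w else 0, by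
    intro h g
    by_cases hg : g ∈ H
    · have hhg : (h : G) * g ∈ H := mul_mem h.2 hg
      have : (⟨(h : G) * g, hhg⟩ : H) = h * ⟨g, hg⟩ := rfl
      change (if hg : (h : G) * g ∈ H then ρ ⟨_, hg⟩ w else 0) =
        ρ h (if hg : g ∈ H then ρ ⟨g, hg⟩ w else 0)
      rw [dif_pos hhg, dif_pos hg, this, map_mul, Module.End.mul_apply]
    · have hhg : (h : G) * g ∉ H := fun hc => hg ((Subgroup.mul_mem_cancel_left H h.2).1 hc)
      change (if hg : (h : G) * g ∈ H then ρ ⟨_, hg⟩ w else 0) =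
        ρ h (if hg : g ∈ H then ρ ⟨g, hg⟩ w else 0)
      rw [dif_neg hhg, dif_neg hg, map_zero]⟩

theorem indPoint_of_mem (w : W) {g : G} (hg : g ∈ H) : (indPoint ρ w).1 g = ρ ⟨g, hg⟩ w :=
  dif_pos hg

theorem indPoint_of_notMem (w : W) {g : G} (hg : g ∉ H) : (indPoint ρ w).1 g = 0 :=
  dif_neg hg

theorem indPoint_one (w : W) : (indPoint ρ w).1 1 = w := by
  rw [indPoint_of_mem ρ w (one_mem H)]
  change ρ 1 w = w
  simp

/-- The translates of the functions supported on `H` span the induced representation. -/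
theorem mem_of_indPoint_mem [H.FiniteIndex] {T : Submodule ℂ (Representation.coindV H.subtype ρ)}
    (hT : ∀ g, ∀ f ∈ T, indRep H ρ g f ∈ T) (hpt : ∀ w, indPoint ρ w ∈ T)
    (f : Representation.coindV H.subtype ρ) : f ∈ T := by
  classical
  have : Fintype (G ⧸ H) := Fintype.ofFinite _
  -- The restriction of f to the coset Hq⁻¹ is a translate by q of the function supported on H with
  -- value f(q⁻¹) at 1.
  have key : f = ∑ q : G ⧸ H, indRep H ρ q.out (indPoint ρ (f.1 q.out⁻¹)) := by
    ext g
    rw [AddSubmonoidClass.coe_finsetSum, Finset.sum_apply,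
      Finset.sum_eq_single ((g⁻¹ : G) : G ⧸ H)]
    · have hm : g * ((g⁻¹ : G) : G ⧸ H).out ∈ H := by
        obtain ⟨h, hh⟩ := QuotientGroup.mk_out_eq_mul H g⁻¹
        rw [hh, mul_inv_cancel_left]
        exact h.2
      rw [indRep_apply, indPoint_of_mem ρ _ hm, ← coindV_apply_mul, mul_inv_cancel_right]
    · intro q _ hq
      rw [indRep_apply, indPoint_of_notMem]
      intro hm
      apply hq
      rw [← QuotientGroup.out_eq' q, eq_comm, QuotientGroup.eq, inv_inv]
      exact hm
    · simp
  rw [key]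
  exact Submodule.sum_mem _ fun q _ => hT _ _ (hpt _)

end Point

section Character

variable (χ : H →* ℂ)

/-- The function supported on `H` and equal to `χ` there. -/
noncomputable abbrev charPoint : Representation.coindV H.subtype (charRep χ) :=
  indPoint (charRep χ) 1

variable {χ}

theorem charRep_apply (h : H) (c : ℂ) : charRep χ h c = χ h * c := rfl

theorem map_mul_map_inv_char (h : H) : χ h * χ h⁻¹ = 1 := by
  rw [← map_mul, mul_inv_cancel, map_one]

theorem coindV_char_apply_mul (f : Representation.coindV H.subtype (charRep χ)) {h : G}
    (hh : h ∈ H) (x : G) : f.1 (h * x) = χ ⟨h, hh⟩ * f.1 x :=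
  coindV_apply_mul f hh x

theorem indRep_charPoint (h : H) :
    indRep H (charRep χ) h (charPoint χ) = χ h • charPoint χ := by
  ext g
  change (charPoint χ).1 (g * h) = χ h * (charPoint χ).1 g
  by_cases hg : g ∈ H
  · rw [indPoint_of_mem _ _ hg, indPoint_of_mem _ _ (mul_mem hg h.2)]
    change χ (⟨g, hg⟩ * h) * 1 = χ h * (χ ⟨g, hg⟩ * 1)
    rw [map_mul, mul_one, mul_one, mul_comm]
  · rw [indPoint_of_notMem _ _ hg, indPoint_of_notMem, mul_zero]
    exact fun hc => hg ((Subgroup.mul_mem_cancel_right H h.2).1 hc)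

theorem charPoint_ne_zero : charPoint χ ≠ 0 := by
  intro h
  have h1 : (charPoint χ).1 1 = 1 := indPoint_one (charRep χ) 1
  rw [h] at h1
  exact zero_ne_one h1

/-! ### Frobenius reciprocity -/

section Lift

variable {X : Type*} [AddCommGroup X] [Module ℂ X] (π : Representation ℂ G X) {φ : X}
  (hφ : ∀ h : H, π h φ = χ h • φ)

-- The factor of f at the inverse cancels the factor χ(h) from φ, so the summand of `indLift`
-- depends only on the coset of g.
include hφ in
theorem smul_apply_mul_inv (f : Representation.coindV H.subtype (charRep χ)) (g : G) {h : G}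
    (hh : h ∈ H) : f.1 (g * h)⁻¹ • π (g * h) φ = f.1 g⁻¹ • π g φ := by
  have h1 := hφ ⟨h, hh⟩
  have h2 := coindV_char_apply_mul f (inv_mem hh) g⁻¹
  rw [mul_inv_rev, h2, map_mul, Module.End.mul_apply, h1, map_smul, smul_smul, mul_right_comm]
  have h3 : χ ⟨h⁻¹, inv_mem hh⟩ * χ ⟨h, hh⟩ = 1 := by
    rw [mul_comm]
    exact map_mul_map_inv_char ⟨h, hh⟩
  rw [h3, one_mul]

/-- The intertwining map from `Ind_H^G χ` that takes the function equal to `χ` on `H` to a given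
vector on which `H` acts through `χ`. -/
noncomputable def indLift [H.FiniteIndex] :
    (indRep H (charRep χ)).IntertwiningMap π :=
  LinearMap.intertwiningMap_of_isIntertwiningMap _ _
    (∑ᶠ q : G ⧸ H, ((LinearMap.proj (R := ℂ) (φ := fun _ : G => ℂ) q.out⁻¹).comp
      (Representation.coindV H.subtype (charRep χ)).subtype).smulRight (π q.out φ)) (by
    classical
    have : Fintype (G ⧸ H) := Fintype.ofFinite _
    intro g f
    rw [finsum_eq_sum_of_fintype, LinearMap.sum_apply, LinearMap.sum_apply, map_sum]
    refine Fintype.sum_equiv (MulAction.toPerm g⁻¹) _ _ fun q => ?_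
    obtain ⟨x, rfl⟩ := QuotientGroup.mk_surjective q
    change (indRep H (charRep χ) g f).1 (x : G ⧸ H).out⁻¹ • π (x : G ⧸ H).out φ =
      π g (f.1 ((g⁻¹ * x : G) : G ⧸ H).out⁻¹ • π ((g⁻¹ * x : G) : G ⧸ H).out φ)
    rw [apply_out_eq (k := fun y => f.1 y⁻¹ • π y φ)
        (fun y h hh => smul_apply_mul_inv π hφ f y hh),
      apply_out_eq (k := fun y => (indRep H (charRep χ) g f).1 y⁻¹ • π y φ)
        (fun y h hh => smul_apply_mul_inv π hφ _ y hh), indRep_apply, map_smul,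
      ← Module.End.mul_apply, ← map_mul]
    simp)

theorem indLift_charPoint [H.FiniteIndex] : indLift π hφ (charPoint χ) = φ := by
  classical
  have : Fintype (G ⧸ H) := Fintype.ofFinite _
  change (∑ᶠ q : G ⧸ H, _ : _ →ₗ[ℂ] X) (charPoint χ) = φ
  rw [finsum_eq_sum_of_fintype, LinearMap.sum_apply, Finset.sum_eq_single ((1 : G) : G ⧸ H)]
  · change (charPoint χ).1 ((1 : G) : G ⧸ H).out⁻¹ • π ((1 : G) : G ⧸ H).out φ = φ
    rw [apply_out_eq (k := fun y => (charPoint χ).1 y⁻¹ • π y φ)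
        (fun y h hh => smul_apply_mul_inv π hφ _ y hh)]
    rw [inv_one, indPoint_one, map_one, one_smul, Module.End.one_apply]
  · intro q _ hq
    change (charPoint χ).1 q.out⁻¹ • π q.out φ = 0
    rw [indPoint_of_notMem, zero_smul]
    intro hm
    apply hq
    rw [← QuotientGroup.out_eq' q, eq_comm, QuotientGroup.eq, inv_one, one_mul]
    exact inv_mem_iff.1 hm
  · simp

end Lift

/-! ### Averaging against a character -/

section Average

variable {X : Type*} [AddCommMonoid X] [Module ℂ X] (π : Representation ℂ G X)
  (N : Subgroup H)

variable (χ) in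
/-- The projection to the vectors on which `H` acts through `χ`, up to a factor. -/
noncomputable def charAverage : Module.End ℂ X :=
  ∑ᶠ q : H ⧸ N, χ q.out⁻¹ • π q.out

theorem charAverage_apply [Fintype (H ⧸ N)] (x : X) :
    charAverage χ π N x = ∑ q : H ⧸ N, χ q.out⁻¹ • π q.out x := by
  rw [charAverage, finsum_eq_sum_of_fintype, LinearMap.sum_apply]
  rfl

variable {π N}

theorem apply_charAverage [N.FiniteIndex] (hχ : ∀ n ∈ N, χ n = 1)
    (hπ : ∀ n : H, n ∈ N → ∀ x, π n x = x) (h : H) (x : X) :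
    π h (charAverage χ π N x) = χ h • charAverage χ π N x := by
  classical
  have : Fintype (H ⧸ N) := Fintype.ofFinite _
  have hk : ∀ g : H, ∀ n ∈ N, χ (g * n)⁻¹ • π (g * n : H) x = χ g⁻¹ • π g x := by
    intro g n hn
    rw [mul_inv_rev, map_mul, hχ _ (inv_mem hn), one_mul, Subgroup.coe_mul, map_mul,
      Module.End.mul_apply, hπ n hn]
  rw [charAverage_apply, map_sum, Finset.smul_sum]
  refine Fintype.sum_equiv (MulAction.toPerm h) _ _ fun q => ?_
  obtain ⟨y, rfl⟩ := QuotientGroup.mk_surjective q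
  change π h (χ (y : H ⧸ N).out⁻¹ • π (y : H ⧸ N).out x) =
    χ h • (χ ((h * y : H) : H ⧸ N).out⁻¹ • π ((h * y : H) : H ⧸ N).out x)
  rw [apply_out_eq (k := fun g : H => χ g⁻¹ • π g x) hk (h * y),
    apply_out_eq (k := fun g : H => χ g⁻¹ • π g x) hk y, map_smul, smul_smul, mul_inv_rev, map_mul,
    Subgroup.coe_mul, map_mul, Module.End.mul_apply, mul_left_comm, map_mul_map_inv_char, mul_one]

theorem charAverage_mem [N.FiniteIndex] {T : Submodule ℂ X} (hT : ∀ g, ∀ x ∈ T, π g x ∈ T) {x : X}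
    (hx : x ∈ T) : charAverage χ π N x ∈ T := by
  classical
  have : Fintype (H ⧸ N) := Fintype.ofFinite _
  rw [charAverage_apply]
  exact Submodule.sum_mem _ fun q _ => Submodule.smul_mem _ _ (hT _ _ hx)

theorem map_charAverage [N.FiniteIndex] {Y : Type*} [AddCommMonoid Y] [Module ℂ Y]
    {π' : Representation ℂ G Y} (F : π.IntertwiningMap π') (x : X) :
    F (charAverage χ π N x) = charAverage χ π' N (F x) := by
  classical
  have : Fintype (H ⧸ N) := Fintype.ofFinite _
  rw [charAverage_apply, charAverage_apply, map_sum]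
  refine Finset.sum_congr rfl fun q _ => ?_
  rw [map_smul, F.isIntertwining]

/-- Every summand contributes f(1), so averaging multiplies the value at 1 by a nonzero integer and
cannot kill it. -/
theorem charAverage_apply_one [N.FiniteIndex] (f : Representation.coindV H.subtype (charRep χ)) :
    (charAverage χ (indRep H (charRep χ)) N f).1 1 = (N.index : ℂ) * f.1 1 := by
  classical
  have : Fintype (H ⧸ N) := Fintype.ofFinite _
  rw [charAverage_apply, AddSubmonoidClass.coe_finsetSum, Finset.sum_apply]
  have : ∀ q : H ⧸ N,
      (χ q.out⁻¹ • indRep H (charRep χ) q.out f).1 1 = f.1 1 := by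
    intro q
    change χ q.out⁻¹ * f.1 (1 * q.out) = _
    rw [one_mul, ← mul_one (q.out : G), coindV_char_apply_mul f q.out.2, ← mul_assoc]
    change χ q.out⁻¹ * χ q.out * _ = _
    rw [mul_comm (χ _), map_mul_map_inv_char, one_mul]
  rw [Finset.sum_congr rfl fun q _ => this q, Finset.sum_const, Finset.card_univ,
    nsmul_eq_mul, Subgroup.index, Nat.card_eq_fintype_card]

end Average

/-! ### Mackey's criterion for a family of characters -/

section Mackey

theorem indRep_apply_eq_self {N : Subgroup G} [N.Normal] (hN : N ≤ H) {χ : H →* ℂ}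
    (hχN : ∀ n : H, (n : G) ∈ N → χ n = 1) {n : G} (hn : n ∈ N)
    (f : Representation.coindV H.subtype (charRep χ)) :
    indRep H (charRep χ) n f = f := by
  ext g
  have hc : g * n * g⁻¹ ∈ N := Subgroup.Normal.conj_mem inferInstance n hn g
  change f.1 (g * n) = f.1 g
  rw [show g * n = g * n * g⁻¹ * g by group, coindV_char_apply_mul f (hN hc),
    hχN ⟨_, hN hc⟩ hc, one_mul]

/-- `k` intertwines the characters `χ'` and `χ` of `H`. -/
def Intertwines (χ' χ : H →* ℂ) (k : G) : Prop :=
  ∀ h h' : H, k * h = h' * k → χ' h' = χ h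

/-- Evaluating f at kh = h'k in two ways gives χ(h) f(k) = χ'(h') f(k). -/
theorem apply_eq_zero_of_not_intertwines {χ' : H →* ℂ}
    {f : Representation.coindV H.subtype (charRep χ')}
    (hf : ∀ h : H, indRep H (charRep χ') h f = χ h • f) {k : G} (hk : ¬ Intertwines χ' χ k) :
    f.1 k = 0 := by
  by_contra h0
  refine hk fun h h' hh => mul_right_cancel₀ h0 ?_
  have h1 := coindV_char_apply_mul f h'.2 k
  have h2 : f.1 (k * h) = χ h * f.1 k := congrFun (congrArg Subtype.val (hf h)) k
  rw [← h2, hh, h1]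

variable {ι : Type*} {χ : ι → H →* ℂ}
  (hχ : ∀ i j k, Intertwines (χ i) (χ j) k → i = j ∧ k ∈ H)

include hχ

theorem eq_smul_charPoint {i : ι} {f : Representation.coindV H.subtype (charRep (χ i))}
    (hf : ∀ h : H, indRep H (charRep (χ i)) h f = χ i h • f) : f = f.1 1 • charPoint (χ i) := by
  ext k
  change f.1 k = f.1 1 * (charPoint (χ i)).1 k
  by_cases hk : k ∈ H
  · rw [indPoint_of_mem _ _ hk]
    nth_rw 1 [← mul_one k]
    rw [coindV_char_apply_mul f hk]
    change _ = f.1 1 * (χ i ⟨k, hk⟩ * 1)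
    ring
  · rw [indPoint_of_notMem _ _ hk, mul_zero]
    exact apply_eq_zero_of_not_intertwines hf fun h => hk (hχ _ _ _ h).2

theorem eq_zero_of_ne {i j : ι} (hij : i ≠ j)
    {f : Representation.coindV H.subtype (charRep (χ i))}
    (hf : ∀ h : H, indRep H (charRep (χ i)) h f = χ j h • f) : f = 0 := by
  ext k
  exact apply_eq_zero_of_not_intertwines hf fun h => hij (hχ _ _ _ h).1

theorem isEmpty_equiv_indRep {i j : ι} (hij : i ≠ j) :
    IsEmpty ((indRep H (charRep (χ i))).Equiv (indRep H (charRep (χ j)))) := by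
  refine ⟨fun e => charPoint_ne_zero (χ := χ i) ?_⟩
  have h0 : e (charPoint (χ i)) = 0 := by
    refine eq_zero_of_ne hχ hij.symm fun h => ?_
    have := e.toIntertwiningMap.isIntertwining _ _ (h : G) (charPoint (χ i))
    rw [indRep_charPoint, map_smul] at this
    exact this.symm
  exact (LinearEquiv.map_eq_zero_iff e.toLinearEquiv).1 h0

variable {N : Subgroup G} [N.Normal] [N.FiniteIndex] (hN : N ≤ H)
  (hχN : ∀ i, ∀ n : H, (n : G) ∈ N → χ i n = 1)

include hN hχN

/-- A stable subspace of the direct sum contains the `i`-th summand as soon as some element of it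
has a nonzero `i`-th component. -/
theorem lof_charPoint_mem [DecidableEq ι] {T : Submodule ℂ
      (DirectSum ι fun i => Representation.coindV H.subtype (charRep (χ i)))}
    (hT : ∀ g, ∀ x ∈ T, Representation.directSum (fun i => indRep H (charRep (χ i))) g x ∈ T)
    {x : DirectSum ι fun i => Representation.coindV H.subtype (charRep (χ i))} (hx : x ∈ T)
    {i : ι} (hxi : x i ≠ 0) : DirectSum.lof ℂ ι _ i (charPoint (χ i)) ∈ T := by
  set Θ := Representation.directSum (fun i => indRep H (charRep (χ i))) with hΘ
  have hcomp : ∀ (g : G) x (j : ι), (Θ g x) j = indRep H (charRep (χ j)) g (x j) :=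
    fun _ _ _ => rfl
  obtain ⟨g, hg⟩ : ∃ g, (x i).1 g ≠ 0 := by
    by_contra! h
    exact hxi (Subtype.ext (funext h))
  -- Translating by g first moves a nonzero value of the i-th component to 1, where the average
  -- preserves it. The average is an eigenvector for χ i, so its other components vanish.
  set y := charAverage (χ i) Θ (N.subgroupOf H) (Θ g x) with hy
  have hyT : y ∈ T := charAverage_mem hT (hT g x hx)
  have hyχ : ∀ h : H, Θ h y = χ i h • y := by
    refine fun h => apply_charAverage (fun n hn => hχN i n hn) (fun n hn z => ?_) h _
    ext1 j
    rw [hcomp]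
    exact indRep_apply_eq_self hN (hχN j) hn _
  have hyj : ∀ j (h : H), indRep H (charRep (χ j)) h (y j) = χ i h • y j := by
    intro j h
    rw [← hcomp, hyχ]
    rfl
  have hyi : y i = ((N.subgroupOf H).index * (x i).1 g) • charPoint (χ i) := by
    rw [eq_smul_charPoint hχ (hyj i)]
    congr 1
    let F : Θ.IntertwiningMap (indRep H (charRep (χ i))) :=
      LinearMap.intertwiningMap_of_isIntertwiningMap _ _
        (DirectSum.component ℂ ι _ i) (fun g x => hcomp g x i)
    have h1 : y i = charAverage (χ i) (indRep H (charRep (χ i))) (N.subgroupOf H)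
        ((Θ g x) i) := map_charAverage F (Θ g x)
    rw [h1, charAverage_apply_one, hcomp, indRep_apply, one_mul]
  have hylof : y = ((N.subgroupOf H).index * (x i).1 g) •
      DirectSum.lof ℂ ι (fun i => Representation.coindV H.subtype (charRep (χ i))) i
        (charPoint (χ i)) := by
    rw [← map_smul, ← hyi]
    ext1 j
    by_cases hij : j = i
    · subst hij
      exact (DirectSum.lof_apply
        (M := fun i => Representation.coindV H.subtype (charRep (χ i))) ℂ j (y j)).symm
    · rw [eq_zero_of_ne hχ hij (hyj j), DirectSum.lof_eq_of, DirectSum.of_eq_of_ne _ _ _ hij]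
  have hc : ((N.subgroupOf H).index * (x i).1 g : ℂ) ≠ 0 :=
    mul_ne_zero (Nat.cast_ne_zero.2 Subgroup.FiniteIndex.index_ne_zero) hg
  rw [hylof] at hyT
  exact (Submodule.smul_mem_iff _ hc).1 hyT

/-- `lof_charPoint_mem` applies to the image of a nonzero subrepresentation under the i-th
inclusion; the vector it yields generates the induced representation. -/
theorem isIrreducible_indRep [H.FiniteIndex] (i : ι) :
    (indRep H (charRep (χ i))).IsIrreducible := by
  classical
  have hnt : Nontrivial (Subrepresentation (indRep H (charRep (χ i)))) := by
    refine ⟨⊥, ⊤, fun h => charPoint_ne_zero (χ := χ i) ?_⟩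
    have : charPoint (χ i) ∈ (⊤ : Subrepresentation (indRep H (charRep (χ i)))).toSubmodule :=
      trivial
    rw [← h] at this
    exact (Submodule.mem_bot ℂ).1 this
  refine { eq_bot_or_eq_top := fun T => or_iff_not_imp_left.2 fun hT => ?_ }
  obtain ⟨f, hfT, hf0⟩ : ∃ f ∈ T.toSubmodule, f ≠ 0 := by
    refine (Submodule.ne_bot_iff _).1 fun h => hT (Subrepresentation.toSubmodule_injective h)
  have hlof := lof_charPoint_mem hχ hN hχN (i := i)
    (T := T.toSubmodule.map (DirectSum.lof ℂ ι _ i)) ?_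
    (Submodule.mem_map_of_mem (f := DirectSum.lof ℂ ι _ i) hfT)
    (by rw [DirectSum.lof_apply]; exact hf0)
  · obtain ⟨f', hf'T, hf'⟩ := hlof
    rw [DirectSum.of_injective (β := fun i => Representation.coindV H.subtype (charRep (χ i))) i
      hf'] at hf'T
    refine Subrepresentation.toSubmodule_injective (eq_top_iff.2 fun z _ => ?_)
    refine mem_of_indPoint_mem _ (fun g x hx => T.apply_mem_toSubmodule g hx) (fun w => ?_) z
    have : indPoint (charRep (χ i)) w = w • charPoint (χ i) := by
      ext g
      change _ = w * (charPoint (χ i)).1 g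
      by_cases hg : g ∈ H
      · rw [indPoint_of_mem _ _ hg, indPoint_of_mem _ _ hg, charRep_apply, charRep_apply]
        ring
      · rw [indPoint_of_notMem _ _ hg, indPoint_of_notMem _ _ hg, mul_zero]
    rw [this]
    exact Submodule.smul_mem _ _ hf'T
  · rintro g _ ⟨z, hz, rfl⟩
    refine ⟨_, T.apply_mem_toSubmodule g hz, ?_⟩
    exact (DirectSum.lmap_lof (fun i => indRep H (charRep (χ i)) g) i z).symm

/-- The kernel is stable, so if it were nonzero it would contain one of the generators excluded by
`hF`. -/
theorem injective_of_lof_charPoint_ne_zero [DecidableEq ι] {X : Type*} [AddCommGroup X] [Module ℂ X]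
    {π : Representation ℂ G X}
    (F : (Representation.directSum fun i => indRep H (charRep (χ i))).IntertwiningMap π)
    (hF : ∀ i, F (DirectSum.lof ℂ ι
      (fun i => Representation.coindV H.subtype (charRep (χ i))) i (charPoint (χ i))) ≠ 0) :
    Function.Injective F := by
  intro a b hab
  by_contra hne
  obtain ⟨i, hi⟩ : ∃ i, (a + (-1 : ℂ) • b) i ≠ 0 := by
    by_contra! h
    refine hne (DFinsupp.ext fun i => ?_)
    ext g
    have h1 : (a i).1 g + (-1 : ℂ) * (b i).1 g = 0 := congrFun (congrArg Subtype.val (h i)) g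
    linear_combination h1
  have hx : a + (-1 : ℂ) • b ∈ F.toLinearMap.ker := by
    change F.toLinearMap (a + (-1 : ℂ) • b) = 0
    have hab' : F.toLinearMap a = F.toLinearMap b := hab
    rw [map_add, map_smul, hab', neg_one_smul, add_neg_cancel]
  refine hF i (lof_charPoint_mem hχ hN hχN (T := F.toLinearMap.ker) ?_ hx hi)
  intro g z hz
  have h1 := F.isIntertwining _ _ g z
  have h2 : F z = 0 := hz
  rw [h2, map_zero] at h1
  exact h1

end Mackey

end Character

end Induced

/-! ### Characters of the ring of integers -/

noncomputable section LocalFieldCharacters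

variable {F : Type*} [Field F] [ValuativeRel F] [TopologicalSpace F]
  [IsNonarchimedeanLocalField F] {ϖ : 𝒪[F]} (hϖ : Irreducible ϖ) {ψ : AddChar F ℂ}
  (hψ : HasConductorMaximalIdeal ψ)

/-- The character `x ↦ ψ (ϖ ^ (-ℓ) x)` of the ring of integers. -/
def levelChar (ϖ : 𝒪[F]) (ψ : AddChar F ℂ) (ℓ : ℕ) : AddChar 𝒪[F] ℂ :=
  ψ.compAddMonoidHom ((AddMonoidHom.mulLeft ((ϖ : F) ^ ℓ)⁻¹).comp
    (algebraMap 𝒪[F] F).toAddMonoidHom)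

omit [TopologicalSpace F] [IsNonarchimedeanLocalField F] in
theorem levelChar_apply (ℓ : ℕ) (x : 𝒪[F]) :
    levelChar ϖ ψ ℓ x = ψ (((ϖ : F) ^ ℓ)⁻¹ * (x : F)) := rfl

include hϖ

omit [TopologicalSpace F] [IsNonarchimedeanLocalField F] in
theorem levelChar_pow_mul (ℓ : ℕ) (x : 𝒪[F]) : levelChar ϖ ψ ℓ (ϖ ^ ℓ * x) = ψ (x : F) := by
  have := coe_uniformizer_ne_zero hϖ
  rw [levelChar_apply]
  congr 1
  push_cast
  field_simp

include hψ

theorem levelChar_eq_one {ℓ : ℕ} {x : 𝒪[F]} (hx : x ∈ maxPow 𝒪[F] (ℓ + 1)) :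
    levelChar ϖ ψ ℓ x = 1 := by
  obtain ⟨y, rfl⟩ := (mem_maxPow_iff hϖ).1 hx
  rw [pow_succ, mul_assoc, levelChar_pow_mul hϖ]
  refine hψ.trivial_on _ (Ideal.mul_mem_right _ _ ?_)
  rw [hϖ.maximalIdeal_eq]
  exact Ideal.mem_span_singleton_self _

theorem levelChar_congr {ℓ : ℕ} {x y : 𝒪[F]} (hxy : x - y ∈ maxPow 𝒪[F] (ℓ + 1)) :
    levelChar ϖ ψ ℓ x = levelChar ϖ ψ ℓ y := by
  rw [← sub_add_cancel x y, AddChar.map_add_eq_mul, levelChar_eq_one hϖ hψ hxy, one_mul]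

/-- If v had valuation j with j + n ≤ ℓ, then vP^n would contain P^ℓ, on which the character takes
all values of ψ on the ring of integers, hence one other than 1. -/
theorem mem_maxPow_of_levelChar {ℓ n : ℕ} (hn : n ≤ ℓ) {v : 𝒪[F]}
    (hv : ∀ x ∈ maxPow 𝒪[F] n, levelChar ϖ ψ ℓ (v * x) = 1) : v ∈ maxPow 𝒪[F] (ℓ + 1 - n) := by
  by_cases hv0 : v = 0
  · rw [hv0]; exact zero_mem _
  obtain ⟨j, w, rfl⟩ := IsDiscreteValuationRing.eq_unit_mul_pow_irreducible hv0 hϖ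
  by_contra hmem
  have hj : j + n ≤ ℓ := by
    by_contra hlt
    refine hmem ((mem_maxPow_iff hϖ).2 (Dvd.dvd.mul_left (pow_dvd_pow _ ?_) _))
    omega
  obtain ⟨y, hy⟩ := hψ.nontrivial
  refine hy ?_
  rw [← hv (ϖ ^ (ℓ - j) * (((w⁻¹ : 𝒪[F]ˣ) : 𝒪[F]) * y)) ?_, ← levelChar_pow_mul hϖ ℓ]
  · congr 1
    have h1 : ϖ ^ ℓ = ϖ ^ j * ϖ ^ (ℓ - j) := by rw [← pow_add]; congr 1; omega
    rw [h1]
    linear_combination (-(ϖ ^ j * ϖ ^ (ℓ - j) * y)) * w.mul_inv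
  · exact Ideal.mul_mem_right _ _ ((mem_maxPow_iff hϖ).2 (pow_dvd_pow _ (by omega)))

omit hϖ

/-- The character of the residue field obtained from `ψ`. -/
def residueChar (hψ : HasConductorMaximalIdeal ψ) : AddChar 𝓀[F] ℂ where
  toFun := Quotient.lift (fun x : 𝒪[F] => ψ (x : F)) (by
    intro a b hab
    have hab' : a - b ∈ 𝓂[F] := (Submodule.quotientRel_def _).1 hab
    have h1 := hψ.trivial_on _ hab'
    have h2 : (a : F) = ((a - b : 𝒪[F]) : F) + (b : F) := by push_cast; ring
    change ψ (a : F) = ψ (b : F)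
    rw [h2, AddChar.map_add_eq_mul, h1, one_mul])
  map_zero_eq_one' := by
    change ψ ((0 : 𝒪[F]) : F) = 1
    simp
  map_add_eq_mul' a b := by
    obtain ⟨a, rfl⟩ := IsLocalRing.residue_surjective a
    obtain ⟨b, rfl⟩ := IsLocalRing.residue_surjective b
    rw [← map_add]
    change ψ ((a + b : 𝒪[F]) : F) = ψ (a : F) * ψ (b : F)
    rw [← AddChar.map_add_eq_mul]
    rfl

omit hψ in
theorem residueChar_residue (hψ : HasConductorMaximalIdeal ψ) (x : 𝒪[F]) :
    residueChar hψ (IsLocalRing.residue 𝒪[F] x) = ψ (x : F) := rfl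

theorem residueChar_ne_one : residueChar hψ ≠ 1 := by
  obtain ⟨x, hx⟩ := hψ.nontrivial
  intro h
  rw [← residueChar_residue hψ, h] at hx
  exact hx rfl

end LocalFieldCharacters

/-! ### The slope `g₁₁⁻¹ g₁₂` -/

section Slope

/-- The quotient `g₁₁⁻¹ g₁₂`. -/
noncomputable def upperSlope {R : Type*} [CommRing R] (g : SL(2, R)) : R := Ring.inverse (g 0 0) * g 0 1

theorem mul_upperSlope {R : Type*} [CommRing R] {g : SL(2, R)} (hg : IsUnit (g 0 0)) :
    g 0 0 * upperSlope g = g 0 1 := by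
  rw [upperSlope, ← mul_assoc, Ring.mul_inverse_cancel _ hg, one_mul]

variable {R : Type*} [CommRing R] [IsLocalRing R]

theorem isUnit_apply_of_mem_lowerTriMod {n : ℕ} (hn : 1 ≤ n) {g : SL(2, R)}
    (hg : g ∈ lowerTriMod R n) : IsUnit (g 0 0) := by
  have h1 : g 0 1 ∈ IsLocalRing.maximalIdeal R := Ideal.pow_le_self (by omega) hg
  by_contra h
  have h3 : g 0 0 ∈ IsLocalRing.maximalIdeal R := h
  have h4 := sub_mem (Ideal.mul_mem_right (g 1 1) _ h3) (Ideal.mul_mem_right (g 1 0) _ h1)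
  rw [SL2_det] at h4
  exact h4 isUnit_one

theorem upperSlope_mem {n k : ℕ} (hn : 1 ≤ n) {g : SL(2, R)} (hg : g ∈ lowerTriMod R n) :
    upperSlope g ∈ maxPow R k ↔ g ∈ lowerTriMod R k := by
  have h := isUnit_apply_of_mem_lowerTriMod hn hg
  rw [← Ideal.unit_mul_mem_iff_mem _ h, mul_upperSlope h]
  rfl

theorem lowerTriMod_anti {a b : ℕ} (hab : a ≤ b) : lowerTriMod R b ≤ lowerTriMod R a :=
  fun _ hg => Ideal.pow_le_pow_right hab hg

theorem intGroupSL_le (ℓ : ℕ) : intGroupSL R ℓ ≤ lowerTriMod R (halfSucc ℓ) :=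
  fun _ hg => (mem_intGroupSL.1 hg).1

theorem mem_maxPow_of_unit_mul {n : ℕ} {a x : R} (ha : IsUnit a) (h : a * x ∈ maxPow R n) :
    x ∈ maxPow R n := (Ideal.unit_mul_mem_iff_mem _ ha).1 h

/-- The determinant gives h₁₁² − 1 = h₁₁(h₁₁ − h₂₂) + h₁₂h₂₁. -/
theorem sq_sub_one_mem {ℓ : ℕ} {h : SL(2, R)} (hh : h ∈ intGroupSL R ℓ) :
    h 0 0 ^ 2 - 1 ∈ maxPow R (halfCeil ℓ) := by
  obtain ⟨h1, h2⟩ := mem_intGroupSL.1 hh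
  have := add_mem (Ideal.mul_mem_left _ (h 0 0) h2)
    (Ideal.mul_mem_right (h 1 0) _ (maxPow_halfSucc_le ℓ h1))
  convert this using 1
  linear_combination SL2_det h

theorem halfSucc_add_halfCeil (ℓ : ℕ) : halfSucc ℓ + halfCeil ℓ = ℓ + 1 := by
  unfold halfSucc halfCeil; omega

theorem mul_mem_maxPow {a b n : ℕ} {x y : R} (hx : x ∈ maxPow R a) (hy : y ∈ maxPow R b)
    (hn : n ≤ a + b) : x * y ∈ maxPow R n := by
  refine Ideal.pow_le_pow_right hn ?_
  rw [pow_add]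
  exact Ideal.mul_mem_mul hx hy

/-- After denominators are cleared, the error is g₁₂ ∈ P^{m'} times an element of P^m, since h₁₁² ≡
1 mod P^m; and m' + m = ℓ + 1. -/
theorem upperSlope_mul_sub_mem {ℓ : ℕ} {g h : SL(2, R)} (hg : g ∈ lowerTriMod R (halfSucc ℓ))
    (hh : h ∈ intGroupSL R ℓ) :
    upperSlope (g * h) - (upperSlope h + upperSlope g) ∈ maxPow R (ℓ + 1) := by
  have h1 : 1 ≤ halfSucc ℓ := by unfold halfSucc; omega
  have hh' := intGroupSL_le ℓ hh
  have ug := isUnit_apply_of_mem_lowerTriMod h1 hg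
  have uh := isUnit_apply_of_mem_lowerTriMod h1 hh'
  have ugh := isUnit_apply_of_mem_lowerTriMod h1 (mul_mem hg hh')
  have sg := mul_upperSlope ug
  have sh := mul_upperSlope uh
  have sgh := mul_upperSlope ugh
  refine mem_maxPow_of_unit_mul ((ugh.mul ug).mul uh) ?_
  have key : g 0 1 * (-(g 0 0 * (h 0 0 ^ 2 - 1)) - h 0 0 * h 1 0 * g 0 1) ∈ maxPow R (ℓ + 1) := by
    refine mul_mem_maxPow hg ?_ (halfSucc_add_halfCeil ℓ).ge
    exact sub_mem (neg_mem (Ideal.mul_mem_left _ _ (sq_sub_one_mem hh)))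
      (Ideal.mul_mem_left _ _ (maxPow_halfSucc_le ℓ hg))
  convert key using 1
  rw [SL2_mul_zero_zero] at sgh ⊢
  rw [SL2_mul_zero_one] at sgh
  linear_combination (g 0 0 * h 0 0) * sgh -
    ((g 0 0 * h 0 0 + g 0 1 * h 1 0) * g 0 0) * sh -
    ((g 0 0 * h 0 0 + g 0 1 * h 1 0) * h 0 0) * sg + (g 0 0 * g 0 1) * SL2_det h

/-- After denominators are cleared, the error is −h₁₂²g₂₁, which lies in P^{2ℓ} ⊆ P^{ℓ+1} because ℓ
≥ 1. -/
theorem upperSlope_mul_sub_mem_left {ℓ n : ℕ} (hℓ : 1 ≤ ℓ) (hn : 1 ≤ n) {h g : SL(2, R)}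
    (hh : h ∈ lowerTriMod R ℓ) (hg : g ∈ lowerTriMod R n) :
    upperSlope (h * g) - (upperSlope g + Ring.inverse (g 0 0) ^ 2 * upperSlope h) ∈ maxPow R (ℓ + 1) := by
  have ug := isUnit_apply_of_mem_lowerTriMod hn hg
  have uh := isUnit_apply_of_mem_lowerTriMod hℓ hh
  have uhg := isUnit_apply_of_mem_lowerTriMod (n := 1) le_rfl
    (mul_mem (lowerTriMod_anti hℓ hh) (lowerTriMod_anti hn hg))
  have sg := mul_upperSlope ug
  have sh := mul_upperSlope uh
  have shg := mul_upperSlope uhg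
  have ig := Ring.mul_inverse_cancel _ ug
  refine mem_maxPow_of_unit_mul ((uhg.mul (ug.pow 2)).mul uh) ?_
  have key : h 0 1 * (-(h 0 1 * g 1 0)) ∈ maxPow R (ℓ + 1) := by
    refine mul_mem_maxPow (b := ℓ) hh (neg_mem (Ideal.mul_mem_right _ _ hh)) (by omega)
  convert key using 1
  rw [SL2_mul_zero_zero] at shg ⊢
  rw [SL2_mul_zero_one] at shg
  generalize Ring.inverse (g 0 0) = i at *
  linear_combination (g 0 0 ^ 2 * h 0 0) * shg -
    ((h 0 0 * g 0 0 + h 0 1 * g 1 0) * g 0 0 * h 0 0) * sg -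
    ((h 0 0 * g 0 0 + h 0 1 * g 1 0)) * sh -
    ((h 0 0 * g 0 0 + h 0 1 * g 1 0) * h 0 0 * upperSlope h * (g 0 0 * i + 1)) * ig +
    (g 0 0 * h 0 0 * h 0 1) * SL2_det g

end Slope

/-! ### Intertwining of the characters of `Γ'(ℓ)` -/

section Mackey

variable {F : Type*} [Field F] [ValuativeRel F] [TopologicalSpace F]
  [IsNonarchimedeanLocalField F] {ϖ : 𝒪[F]} (hϖ : Irreducible ϖ) {ψ : AddChar F ℂ}
  (hψ : HasConductorMaximalIdeal ψ) {ℓ : ℕ}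

theorem etaHat_eq_levelChar (u : 𝒪[F]ˣ) (g : intGroupSL 𝒪[F] ℓ) :
    etaHat hϖ hψ u ℓ g = levelChar ϖ ψ ℓ (u * upperSlope g.1) := by
  have hu := isUnit_apply_of_mem_intGroupSL g.2
  have h0 : ((g.1 0 0 : 𝒪[F]) : F) ≠ 0 := by
    obtain ⟨a, ha⟩ := hu
    rw [← ha]
    simp
  have hs := congrArg (Subtype.val : 𝒪[F] → F) (mul_upperSlope hu)
  change ψ (etaArg ϖ u ℓ g.1) = ψ _
  congr 1
  change _ = ((ϖ : F) ^ ℓ)⁻¹ * ((u * upperSlope g.1 : 𝒪[F]) : F)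
  push_cast at hs ⊢
  rw [etaArg, ← hs]
  field_simp

theorem etaHat_eq_of_sub_mem (u : 𝒪[F]ˣ) (g : intGroupSL 𝒪[F] ℓ) {s : 𝒪[F]}
    (hs : g.1 0 0 * s - g.1 0 1 ∈ maxPow 𝒪[F] (ℓ + 1)) :
    etaHat hϖ hψ u ℓ g = levelChar ϖ ψ ℓ (u * s) := by
  have hu := isUnit_apply_of_mem_intGroupSL g.2
  rw [etaHat_eq_levelChar]
  refine levelChar_congr hϖ hψ ?_
  rw [← mul_sub]
  refine Ideal.mul_mem_left _ _ (mem_maxPow_of_unit_mul hu ?_)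
  have := neg_mem hs
  convert this using 1
  linear_combination mul_upperSlope hu

include hϖ in
theorem pow_mul_mem_maxPow {n k : ℕ} (hn : n ≤ k) (x : 𝒪[F]) :
    ϖ ^ k * x ∈ maxPow 𝒪[F] n :=
  (mem_maxPow_iff hϖ).2 (Dvd.dvd.mul_right (pow_dvd_pow _ hn) _)

theorem mem_lowerTriMod_of_intertwines (hℓ : 1 ≤ ℓ) {u u' : 𝒪[F]ˣ} {k : SL(2, 𝒪[F])}
    (hk : Intertwines (etaHat hϖ hψ u' ℓ) (etaHat hϖ hψ u ℓ) k) :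
    k ∈ lowerTriMod 𝒪[F] (halfSucc ℓ) := by
  by_contra hmem
  change ¬ (k 0 1 ∈ maxPow 𝒪[F] (halfSucc ℓ)) at hmem
  have hb0 : k 0 1 ≠ 0 := by
    intro h
    rw [h] at hmem
    exact hmem (zero_mem _)
  obtain ⟨j, w, hjw⟩ := IsDiscreteValuationRing.eq_unit_mul_pow_irreducible hb0 hϖ
  have hj : 2 * j ≤ ℓ := by
    by_contra hlt
    refine hmem ((mem_maxPow_iff hϖ).2 (hjw ▸ Dvd.dvd.mul_left (pow_dvd_pow _ ?_) _))
    unfold halfSucc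
    omega
  obtain ⟨y, hy⟩ := hψ.nontrivial
  -- This c, integral because 2j ≤ ℓ, satisfies c k₁₂² = −ϖ^ℓ y/u'. The character of u' then takes
  -- the value ψ(y) ≠ 1 at the conjugate h' of `lowerUnip c`, whereas that of u is trivial on lower
  -- unipotents.
  set c : 𝒪[F] := ϖ ^ (ℓ - 2 * j) * (((w⁻¹ : 𝒪[F]ˣ) : 𝒪[F]) ^ 2 * (-y * ((u'⁻¹ : 𝒪[F]ˣ) : 𝒪[F])))
    with hc
  have hwi := w.mul_inv
  have hcb : c * k 0 1 = ϖ ^ (ℓ - j) * (((w⁻¹ : 𝒪[F]ˣ) : 𝒪[F]) * (-y * ((u'⁻¹ : 𝒪[F]ˣ) : 𝒪[F]))) := by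
    have h1 : ϖ ^ (ℓ - j) = ϖ ^ (ℓ - 2 * j) * ϖ ^ j := by rw [← pow_add]; congr 1; omega
    rw [hc, hjw, h1]
    generalize ((w⁻¹ : 𝒪[F]ˣ) : 𝒪[F]) = wi at *
    linear_combination (ϖ ^ (ℓ - 2 * j) * ϖ ^ j * wi * (-y * ((u'⁻¹ : 𝒪[F]ˣ) : 𝒪[F]))) * hwi
  have hcb2 : c * k 0 1 * k 0 1 = ϖ ^ ℓ * (-y * ((u'⁻¹ : 𝒪[F]ˣ) : 𝒪[F])) := by
    have h1 : ϖ ^ ℓ = ϖ ^ (ℓ - j) * ϖ ^ j := by rw [← pow_add]; congr 1; omega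
    rw [hcb, hjw, h1]
    linear_combination (ϖ ^ (ℓ - j) * ϖ ^ j * (-y * ((u'⁻¹ : 𝒪[F]ˣ) : 𝒪[F]))) * hwi
  have hdet := SL2_det k
  let h' : SL(2, 𝒪[F]) := ⟨!![1 + c * k 0 1 * k 1 1, -(c * k 0 1 * k 0 1);
    c * k 1 1 * k 1 1, 1 - c * k 0 1 * k 1 1], by rw [Matrix.det_fin_two_of]; ring⟩
  have e00 : h' 0 0 = 1 + c * k 0 1 * k 1 1 := rfl
  have e01 : h' 0 1 = -(c * k 0 1 * k 0 1) := rfl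
  have e10 : h' 1 0 = c * k 1 1 * k 1 1 := rfl
  have e11 : h' 1 1 = 1 - c * k 0 1 * k 1 1 := rfl
  have hh : lowerUnip c ∈ intGroupSL 𝒪[F] ℓ := by
    rw [mem_intGroupSL]
    constructor <;> simp
  have hh' : h' ∈ intGroupSL 𝒪[F] ℓ := by
    rw [mem_intGroupSL, e00, e01, e11, hcb2, hcb]
    constructor
    · exact neg_mem (pow_mul_mem_maxPow hϖ (by unfold halfSucc; omega) _)
    · have := pow_mul_mem_maxPow hϖ (n := halfCeil ℓ) (k := ℓ - j) (by unfold halfCeil; omega)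
        (2 * (((w⁻¹ : 𝒪[F]ˣ) : 𝒪[F]) * (-y * ((u'⁻¹ : 𝒪[F]ˣ) : 𝒪[F]))) * k 1 1)
      convert this using 1
      ring
  have hkh : k * lowerUnip c = h' * k := by
    apply SL2_ext <;>
      simp only [SL2_mul_zero_zero, SL2_mul_zero_one, SL2_mul_one_zero, SL2_mul_one_one,
        e00, e01, e10, e11, lowerUnip_zero_zero, lowerUnip_zero_one, lowerUnip_one_zero,
        lowerUnip_one_one]
    · linear_combination (-c * k 0 1) * hdet
    · ring
    · linear_combination (-c * k 1 1) * hdet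
    · ring
  have h1 := hk ⟨_, hh⟩ ⟨_, hh'⟩ hkh
  rw [etaHat_eq_of_sub_mem hϖ hψ u ⟨_, hh⟩ (s := 0) (by simp),
    etaHat_eq_of_sub_mem hϖ hψ u' ⟨_, hh'⟩ (s := -(c * k 0 1 * k 0 1)) ?_] at h1
  · rw [mul_zero, AddChar.map_zero_eq_one, hcb2] at h1
    apply hy
    rw [← h1, ← levelChar_pow_mul hϖ ℓ]
    congr 1
    linear_combination (-ϖ ^ ℓ * y) * u'.mul_inv
  · change h' 0 0 * _ - h' 0 1 ∈ _
    have h2 := mul_mem_maxPow (n := ℓ + 1)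
      (pow_mul_mem_maxPow hϖ (le_refl (ℓ - j))
        ((((w⁻¹ : 𝒪[F]ˣ) : 𝒪[F]) * (-y * ((u'⁻¹ : 𝒪[F]ˣ) : 𝒪[F])))))
      (pow_mul_mem_maxPow hϖ (le_refl ℓ) (-y * ((u'⁻¹ : 𝒪[F]ˣ) : 𝒪[F])))
      (by omega)
    rw [← hcb, ← hcb2] at h2
    have h3 := Ideal.mul_mem_left _ (-k 1 1) h2
    rw [e00, e01]
    convert h3 using 1
    ring

/-- For x ∈ P^{m'}, conjugation by k turns the upper right entry x into x k₁₁². Comparing characters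
shows that u'k₁₁² − u annihilates P^{m'}, so it lies in P^{ℓ+1−m'} = P^m. -/
theorem sq_mul_sub_mem_of_intertwines {u u' : 𝒪[F]ˣ} {k : SL(2, 𝒪[F])}
    (hk : Intertwines (etaHat hϖ hψ u' ℓ) (etaHat hϖ hψ u ℓ) k) :
    (u' : 𝒪[F]) * k 0 0 ^ 2 - u ∈ maxPow 𝒪[F] (halfCeil ℓ) := by
  have hsum := halfSucc_add_halfCeil ℓ
  have hle : halfCeil ℓ ≤ halfSucc ℓ := by unfold halfCeil halfSucc; omega
  have hdet := SL2_det k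
  -- Here m' = 1 > ℓ, outside the range of `mem_maxPow_of_levelChar`, but m = 0 makes the claim
  -- empty.
  by_cases hℓ : ℓ = 0
  · subst hℓ
    simp [maxPow, halfCeil]
  have hmem := mem_maxPow_of_levelChar hϖ hψ (ℓ := ℓ) (n := halfSucc ℓ)
    (v := (u' : 𝒪[F]) * k 0 0 ^ 2 - u) (by unfold halfSucc; omega) ?_
  · rwa [show ℓ + 1 - halfSucc ℓ = halfCeil ℓ by omega] at hmem
  intro x hx
  let h' : SL(2, 𝒪[F]) := ⟨!![1 - x * k 0 0 * k 1 0, x * k 0 0 * k 0 0;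
    -(x * k 1 0 * k 1 0), 1 + x * k 0 0 * k 1 0], by rw [Matrix.det_fin_two_of]; ring⟩
  have e00 : h' 0 0 = 1 - x * k 0 0 * k 1 0 := rfl
  have e01 : h' 0 1 = x * k 0 0 * k 0 0 := rfl
  have e10 : h' 1 0 = -(x * k 1 0 * k 1 0) := rfl
  have e11 : h' 1 1 = 1 + x * k 0 0 * k 1 0 := rfl
  have hh : upperUnip x ∈ intGroupSL 𝒪[F] ℓ := by
    rw [mem_intGroupSL]
    exact ⟨hx, by simp⟩
  have hh' : h' ∈ intGroupSL 𝒪[F] ℓ := by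
    rw [mem_intGroupSL, e00, e01, e11]
    refine ⟨Ideal.mul_mem_right _ _ (Ideal.mul_mem_right _ _ hx), ?_⟩
    have := Ideal.mul_mem_right (-2 * k 0 0 * k 1 0) _ (maxPow_halfSucc_le ℓ hx)
    convert this using 1
    ring
  have hkh : k * upperUnip x = h' * k := by
    apply SL2_ext <;>
      simp only [SL2_mul_zero_zero, SL2_mul_zero_one, SL2_mul_one_zero, SL2_mul_one_one,
        e00, e01, e10, e11, upperUnip_zero_zero, upperUnip_zero_one, upperUnip_one_zero,
        upperUnip_one_one]
    · ring
    · linear_combination (-x * k 0 0) * hdet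
    · ring
    · linear_combination (-x * k 1 0) * hdet
  have h1 := hk ⟨_, hh⟩ ⟨_, hh'⟩ hkh
  rw [etaHat_eq_of_sub_mem hϖ hψ u ⟨_, hh⟩ (s := x) (by simp),
    etaHat_eq_of_sub_mem hϖ hψ u' ⟨_, hh'⟩ (s := x * k 0 0 * k 0 0) ?_] at h1
  · have h2 : (u' : 𝒪[F]) * (x * k 0 0 * k 0 0) =
        ((u' : 𝒪[F]) * k 0 0 ^ 2 - u) * x + u * x := by ring
    rw [h2, AddChar.map_add_eq_mul] at h1
    exact mul_right_cancel₀ (AddChar.val_isUnit _ _).ne_zero (h1.trans (one_mul _).symm)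
  · change h' 0 0 * _ - h' 0 1 ∈ _
    rw [e00, e01]
    have h3 := Ideal.mul_mem_left _ (-k 0 0 ^ 3 * k 1 0)
      (mul_mem_maxPow (n := ℓ + 1) hx hx (by omega))
    convert h3 using 1
    ring

/-! ### Square classes of units -/

theorem mem_squareClassSubgroup_iff {R : Type*} [CommRing R] [IsLocalRing R] {n : ℕ} {t : Rˣ} :
    t ∈ squareClassSubgroup R n ↔ ∃ a : Rˣ, (a : R) ^ 2 - t ∈ maxPow R n := by
  rw [squareClassSubgroup, Subgroup.mem_sup]
  have hker : ∀ z : Rˣ, z ∈ (Units.map (Ideal.Quotient.mk (maxPow R n)).toMonoidHom).ker ↔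
      (z : R) - 1 ∈ maxPow R n := by
    intro z
    rw [MonoidHom.mem_ker, Units.ext_iff, ← Ideal.Quotient.mk_eq_mk_iff_sub_mem]
    rfl
  constructor
  · rintro ⟨_, ⟨a, rfl⟩, z, hz, rfl⟩
    refine ⟨a, ?_⟩
    have := Ideal.mul_mem_left _ (-(a : R) ^ 2) ((hker z).1 hz)
    convert this using 1
    simp only [powMonoidHom_apply, Units.val_mul, Units.val_pow_eq_pow_val]
    ring
  · rintro ⟨a, ha⟩
    refine ⟨a ^ 2, ⟨a, rfl⟩, (a ^ 2)⁻¹ * t, ?_, by group⟩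
    rw [hker]
    have := Ideal.mul_mem_left _ (-(((a ^ 2)⁻¹ : Rˣ) : R)) ha
    convert this using 1
    rw [Units.val_mul]
    have h1 := (a ^ 2).inv_mul
    rw [Units.val_pow_eq_pow_val] at h1
    linear_combination h1

theorem IsSquareClassReps.eq_of_sub_mem {R : Type*} [CommRing R] [IsLocalRing R] {n : ℕ}
    {S : Set Rˣ} (hS : IsSquareClassReps R n S) {u u' : Rˣ} (hu : u ∈ S) (hu' : u' ∈ S) {a : Rˣ}
    (h : (u' : R) * (a : R) ^ 2 - u ∈ maxPow R n) : u' = u := by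
  have ht : u'⁻¹ * u ∈ squareClassSubgroup R n := by
    refine mem_squareClassSubgroup_iff.2 ⟨a, ?_⟩
    have := Ideal.mul_mem_left _ ((u'⁻¹ : Rˣ) : R) h
    convert this using 1
    rw [Units.val_mul]
    linear_combination (-(a : R) ^ 2) * u'.inv_mul
  have := hS.1 (a₁ := (⟨u', hu'⟩, ⟨u'⁻¹ * u, ht⟩)) (a₂ := (⟨u, hu⟩, ⟨1, one_mem _⟩)) (by simp)
  exact congrArg (fun p => (p.1 : Rˣ)) this

theorem IsSquareClassReps.exists_sub_mem {R : Type*} [CommRing R] [IsLocalRing R] {n : ℕ}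
    {S : Set Rˣ} (hS : IsSquareClassReps R n S) (v : Rˣ) :
    ∃ u ∈ S, ∃ a : Rˣ, (u : R) * (a : R) ^ 2 - v ∈ maxPow R n := by
  obtain ⟨⟨⟨u, hu⟩, ⟨t, ht⟩⟩, rfl⟩ := hS.2 v
  obtain ⟨a, ha⟩ := mem_squareClassSubgroup_iff.1 ht
  refine ⟨u, hu, a, ?_⟩
  have := Ideal.mul_mem_left _ (u : R) ha
  convert this using 1
  simp only [Units.val_mul]
  ring

theorem eq_and_mem_of_intertwines (hℓ : 1 ≤ ℓ) {S : Set 𝒪[F]ˣ}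
    (hS : IsSquareClassReps 𝒪[F] (halfCeil ℓ) S) (u u' : S) (k : SL(2, 𝒪[F]))
    (hk : Intertwines (etaHat hϖ hψ (u : 𝒪[F]ˣ) ℓ) (etaHat hϖ hψ (u' : 𝒪[F]ˣ) ℓ) k) :
    u = u' ∧ k ∈ intGroupSL 𝒪[F] ℓ := by
  have hkM := mem_lowerTriMod_of_intertwines hϖ hψ hℓ hk
  have hu := isUnit_apply_of_mem_lowerTriMod (by unfold halfSucc; omega) hkM
  have hsq := sq_mul_sub_mem_of_intertwines hϖ hψ hk
  have huu : u = u' := by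
    obtain ⟨a, ha⟩ := hu
    rw [← ha] at hsq
    exact Subtype.ext (hS.eq_of_sub_mem u'.2 u.2 hsq)
  refine ⟨huu, mem_intGroupSL.2 ⟨hkM, ?_⟩⟩
  subst huu
  -- For u = u' the congruence reads u k₁₁² ≡ u; substituting the determinant gives u k₁₁(k₁₁ − k₂₂)
  -- ≡ 0 mod P^m.
  refine mem_maxPow_of_unit_mul (((u : 𝒪[F]ˣ).isUnit).mul hu) ?_
  have := sub_mem hsq
    (Ideal.mul_mem_left _ ((u : 𝒪[F]ˣ) * k 1 0 : 𝒪[F]) (maxPow_halfSucc_le ℓ hkM))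
  convert this using 1
  linear_combination (-((u : 𝒪[F]ˣ) : 𝒪[F])) * SL2_det k

/-! ### A normal subgroup of finite index on which all the characters are trivial -/

/-- The kernel of reduction modulo `P ^ n`. -/
noncomputable def principalCongr (R : Type*) [CommRing R] [IsLocalRing R] (n : ℕ) :
    Subgroup SL(2, R) :=
  (Matrix.SpecialLinearGroup.map (n := Fin 2) (Ideal.Quotient.mk (maxPow R n))).ker

instance (R : Type*) [CommRing R] [IsLocalRing R] (n : ℕ) : (principalCongr R n).Normal :=
  MonoidHom.normal_ker _

theorem finite_quotient_maxPow (n : ℕ) : Finite (𝒪[F] ⧸ maxPow 𝒪[F] n) := by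
  have : Finite (𝒪[F] ⧸ IsLocalRing.maximalIdeal 𝒪[F]) := inferInstanceAs (Finite 𝓀[F])
  exact Ideal.finite_quotient_pow (IsNoetherian.noetherian _) n

instance (n : ℕ) : (principalCongr 𝒪[F] n).FiniteIndex := by
  have := finite_quotient_maxPow (F := F) n
  have : Finite SL(2, 𝒪[F] ⧸ maxPow 𝒪[F] n) :=
    Finite.of_injective (fun g : SL(2, 𝒪[F] ⧸ maxPow 𝒪[F] n) => g.1) Subtype.coe_injective
  exact Subgroup.finiteIndex_ker _

theorem apply_sub_mem_of_mem_principalCongr {R : Type*} [CommRing R] [IsLocalRing R] {n : ℕ}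
    {g : SL(2, R)} (hg : g ∈ principalCongr R n) (i j : Fin 2) :
    g i j - (1 : SL(2, R)) i j ∈ maxPow R n := by
  have h : Matrix.SpecialLinearGroup.map (Ideal.Quotient.mk (maxPow R n)) g =
    Matrix.SpecialLinearGroup.map (Ideal.Quotient.mk (maxPow R n)) 1 := by
      rw [map_one]; exact hg
  rw [← Ideal.Quotient.mk_eq_mk_iff_sub_mem]
  exact congrFun (congrFun (congrArg Subtype.val h) i) j

theorem principalCongr_le_lowerTriMod {R : Type*} [CommRing R] [IsLocalRing R] {n : ℕ} :
    principalCongr R n ≤ lowerTriMod R n := fun g hg => by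
  have := apply_sub_mem_of_mem_principalCongr hg 0 1
  rw [show (1 : SL(2, R)) 0 1 = 0 from rfl, sub_zero] at this
  exact this

theorem principalCongr_le_intGroupSL (ℓ : ℕ) :
    principalCongr 𝒪[F] (ℓ + 1) ≤ intGroupSL 𝒪[F] ℓ := fun g hg => by
  have h1 : maxPow 𝒪[F] (ℓ + 1) ≤ maxPow 𝒪[F] (halfSucc ℓ) :=
    Ideal.pow_le_pow_right (by unfold halfSucc; omega)
  refine mem_intGroupSL.2 ⟨h1 (principalCongr_le_lowerTriMod hg), ?_⟩
  refine maxPow_halfSucc_le ℓ (h1 ?_)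
  have := sub_mem (apply_sub_mem_of_mem_principalCongr hg 0 0)
    (apply_sub_mem_of_mem_principalCongr hg 1 1)
  rw [show (1 : SL(2, 𝒪[F])) 0 0 = 1 from rfl, show (1 : SL(2, 𝒪[F])) 1 1 = 1 from rfl,
    sub_sub_sub_cancel_right] at this
  exact this

theorem etaHat_eq_one_of_mem_principalCongr (u : 𝒪[F]ˣ) (g : intGroupSL 𝒪[F] ℓ)
    (hg : g.1 ∈ principalCongr 𝒪[F] (ℓ + 1)) : etaHat hϖ hψ u ℓ g = 1 := by
  rw [etaHat_eq_of_sub_mem hϖ hψ u g (s := 0), mul_zero, AddChar.map_zero_eq_one]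
  rw [mul_zero, zero_sub]
  exact neg_mem (principalCongr_le_lowerTriMod hg)

instance : (intGroupSL 𝒪[F] ℓ).FiniteIndex :=
  Subgroup.finiteIndex_of_le (principalCongr_le_intGroupSL ℓ)

instance : (lowerTriMod 𝒪[F] ℓ).FiniteIndex :=
  Subgroup.finiteIndex_of_le (principalCongr_le_lowerTriMod (n := ℓ))

end Mackey

/-! ### The vectors of the Mackey component on which `Γ'(ℓ)` acts by a character -/

noncomputable section MackeyComponent

variable {F : Type*} [Field F] [ValuativeRel F] [TopologicalSpace F]
  [IsNonarchimedeanLocalField F] {ϖ : 𝒪[F]} (hϖ : Irreducible ϖ) {ψ : AddChar F ℂ}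
  (hψ : HasConductorMaximalIdeal ψ) {ℓ : ℕ}
  {V : Type*} [AddCommGroup V] [Module ℂ V] (σ : Representation ℂ SL(2, 𝓀[F]) V)

open Classical in
/-- The residue class of `x`, as a unit; it is `1` if `x` is not a unit. -/
def resUnit {R : Type*} [CommRing R] [IsLocalRing R] (x : R) : (IsLocalRing.ResidueField R)ˣ :=
  if h : IsUnit x then Units.map (IsLocalRing.residue R : R →* _) h.unit else 1

/-- A representative of a class modulo an ideal. -/
def quotRep {R : Type*} [CommRing R] (I : Ideal R) (q : R ⧸ I) : R :=
  Function.surjInv Ideal.Quotient.mk_surjective q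

theorem mk_quotRep {R : Type*} [CommRing R] (I : Ideal R) (q : R ⧸ I) :
    Ideal.Quotient.mk I (quotRep I q) = q :=
  Function.surjInv_eq Ideal.Quotient.mk_surjective q

section ResUnit

variable {R : Type*} [CommRing R] [IsLocalRing R]

theorem coe_resUnit {x : R} (hx : IsUnit x) : (resUnit x : IsLocalRing.ResidueField R) =
    IsLocalRing.residue R x := by
  rw [resUnit, dif_pos hx]
  rfl

theorem resUnit_mul {x y : R} (hx : IsUnit x) (hy : IsUnit y) :
    resUnit (x * y) = resUnit x * resUnit y := by
  ext
  rw [Units.val_mul, coe_resUnit hx, coe_resUnit hy, coe_resUnit (hx.mul hy), map_mul]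

theorem resUnit_congr {x y : R} (hx : IsUnit x) (hy : IsUnit y)
    (hxy : x - y ∈ IsLocalRing.maximalIdeal R) : resUnit x = resUnit y := by
  ext
  rw [coe_resUnit hx, coe_resUnit hy, ← sub_eq_zero, ← map_sub]
  exact Ideal.Quotient.eq_zero_iff_mem.2 hxy

end ResUnit

theorem gEllConj_apply {h : lowerTriMod 𝒪[F] ℓ} {b : 𝒪[F]} (hb : h.1 0 1 = ϖ ^ ℓ * b) :
    (gEllConj hϖ ℓ h) 0 0 = h.1 0 0 ∧ (gEllConj hϖ ℓ h) 0 1 = b ∧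
      (gEllConj hϖ ℓ h) 1 0 = ϖ ^ ℓ * h.1 1 0 ∧ (gEllConj hϖ ℓ h) 1 1 = h.1 1 1 := by
  have h1 := inclGL_gEllConj hϖ ℓ h
  rw [mul_assoc, eq_inv_mul_iff_mul_eq] at h1
  have h2 : !![(ϖ : F) ^ ℓ, 0; 0, 1] *
        ((gEllConj hϖ ℓ h : Matrix (Fin 2) (Fin 2) 𝒪[F]).map fun x : 𝒪[F] => (x : F)) =
      ((h.1 : Matrix (Fin 2) (Fin 2) 𝒪[F]).map fun x : 𝒪[F] => (x : F)) *
        !![(ϖ : F) ^ ℓ, 0; 0, 1] := congrArg Units.val h1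
  have hp : (ϖ : F) ^ ℓ ≠ 0 := pow_ne_zero _ (coe_uniformizer_ne_zero hϖ)
  have hbF := congrArg (Subtype.val : 𝒪[F] → F) hb
  have e00 := congrFun (congrFun h2 0) 0
  have e01 := congrFun (congrFun h2 0) 1
  have e10 := congrFun (congrFun h2 1) 0
  have e11 := congrFun (congrFun h2 1) 1
  simp only [Matrix.mul_apply, Fin.sum_univ_two, Matrix.map_apply, Matrix.of_apply,
    Matrix.cons_val', Matrix.cons_val_zero, Matrix.cons_val_one, Matrix.cons_val_fin_one,
    zero_mul, add_zero, mul_zero, one_mul, zero_add, mul_one] at e00 e01 e10 e11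
  refine ⟨?_, ?_, ?_, ?_⟩ <;> apply Subtype.ext
  · refine mul_left_cancel₀ hp ?_
    rw [e00, mul_comm]
  · refine mul_left_cancel₀ hp ?_
    rw [e01, hbF]
    push_cast
    rfl
  · rw [e10]
    push_cast
    ring
  · exact e11

variable {σ}

include hϖ in
theorem residue_pow_mul (hℓ : 1 ≤ ℓ) (x : 𝒪[F]) :
    IsLocalRing.residue 𝒪[F] (ϖ ^ ℓ * x) = 0 := by
  refine Ideal.Quotient.eq_zero_iff_mem.2 (Ideal.mul_mem_right _ _ ?_)
  rw [hϖ.maximalIdeal_eq]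
  exact Ideal.pow_mem_of_mem _ (Ideal.mem_span_singleton_self _) _ (by omega)

/-- The lower left entry of g_ℓ⁻¹hg_ℓ is divisible by ϖ^ℓ, so modulo P this matrix is a diagonal one
times an upper unipotent one, and v is an eigenvector of the latter. -/
theorem twistedRep_apply (hℓ : 1 ≤ ℓ) {u : 𝒪[F]} {v : V}
    (hv : v ∈ whittaker σ ((residueChar hψ).mulShift (IsLocalRing.residue 𝒪[F] u)))
    (h : lowerTriMod 𝒪[F] ℓ) :
    twistedRep hϖ σ ℓ h v =
      levelChar ϖ ψ ℓ (u * upperSlope h.1) • σ (diagSL (resUnit (h.1 0 0))) v := by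
  have hu := isUnit_apply_of_mem_lowerTriMod hℓ h.2
  obtain ⟨b, hb⟩ := (mem_maxPow_iff hϖ).1 h.2
  obtain ⟨e00, e01, e10, e11⟩ := gEllConj_apply hϖ hb
  set s := Ring.inverse (h.1 0 0) * b with hs
  have hs0 : h.1 0 0 * s = b := by rw [hs, ← mul_assoc, Ring.mul_inverse_cancel _ hu, one_mul]
  have hslope : upperSlope h.1 = ϖ ^ ℓ * s := by rw [upperSlope, hb, hs]; ring
  have hred : Matrix.SpecialLinearGroup.map (IsLocalRing.residue 𝒪[F]) (gEllConj hϖ ℓ h) =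
      diagSL (resUnit (h.1 0 0)) * upperUnip (IsLocalRing.residue 𝒪[F] s) := by
    have hdet := congrArg (IsLocalRing.residue 𝒪[F]) (SL2_det h.1)
    rw [hb, map_sub, map_mul, map_one, mul_assoc, residue_pow_mul hϖ hℓ, sub_zero] at hdet
    have hr := coe_resUnit hu
    have hinv : (((resUnit (h.1 0 0))⁻¹ : (𝓀[F])ˣ) : 𝓀[F]) =
        IsLocalRing.residue 𝒪[F] (h.1 1 1) := by
      rw [← hr] at hdet
      exact Units.inv_eq_of_mul_eq_one_right hdet
    apply SL2_ext <;>
      simp only [SL2_mul_zero_zero, SL2_mul_zero_one, SL2_mul_one_zero, SL2_mul_one_one,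
        map_SL2_apply, diagSL_zero_zero, diagSL_zero_one, diagSL_one_zero, diagSL_one_one,
        upperUnip_zero_zero, upperUnip_zero_one, upperUnip_one_zero, upperUnip_one_one,
        e00, e01, e10, e11, hr, hinv, residue_pow_mul hϖ hℓ]
    · ring
    · rw [← map_mul, hs0]; ring
    · ring
    · ring
  change σ (Matrix.SpecialLinearGroup.map (IsLocalRing.residue 𝒪[F]) (gEllConj hϖ ℓ h)) v = _
  rw [hred, map_mul, Module.End.mul_apply, mem_whittaker.1 hv, map_smul, AddChar.mulShift_apply,
    ← map_mul (IsLocalRing.residue 𝒪[F]), residueChar_residue, hslope, show u * (ϖ ^ ℓ * s) = ϖ ^ ℓ * (u * s) by ring,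
    levelChar_pow_mul hϖ]

theorem one_le_halfSucc (ℓ : ℕ) : 1 ≤ halfSucc ℓ := by unfold halfSucc; omega

theorem halfSucc_le (hℓ : 1 ≤ ℓ) : halfSucc ℓ ≤ ℓ := by unfold halfSucc; omega

open Classical in
variable (ϖ ψ ℓ σ) in
/-- The function `g ↦ ψ (u ϖ ^ (-ℓ) g₁₁⁻¹ g₁₂) σ (diag (g₁₁, g₁₁⁻¹)) w` on the matrices that are
lower triangular modulo `P ^ m'`, extended by zero. -/
def kirillovFun (u : 𝒪[F]) (w : V) (g : SL(2, 𝒪[F])) : V :=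
  if g ∈ lowerTriMod 𝒪[F] (halfSucc ℓ) then
    levelChar ϖ ψ ℓ (u * upperSlope g) • σ (diagSL (resUnit (g 0 0))) w
  else 0

theorem residue_inverse {x : 𝒪[F]} (hx : IsUnit x) : IsLocalRing.residue 𝒪[F] (Ring.inverse x) =
    (((resUnit x)⁻¹ : (𝓀[F])ˣ) : 𝓀[F]) := by
  have := congrArg (IsLocalRing.residue 𝒪[F]) (Ring.mul_inverse_cancel _ hx)
  rw [map_mul, map_one, ← coe_resUnit hx] at this
  exact (Units.inv_eq_of_mul_eq_one_right this).symm

/-- The diagonal matrix of g₁₁ moves w to the character with parameter u g₁₁⁻². This is the factor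
with which the slope of h enters that of hg in `upperSlope_mul_sub_mem_left`. -/
theorem kirillovFun_mem (hℓ : 1 ≤ ℓ) {u : 𝒪[F]} {w : V}
    (hw : w ∈ whittaker σ ((residueChar hψ).mulShift (IsLocalRing.residue 𝒪[F] u))) :
    kirillovFun ϖ ψ ℓ σ u w ∈
      Representation.coindV (lowerTriMod 𝒪[F] ℓ).subtype (twistedRep hϖ σ ℓ) := by
  intro h g
  change kirillovFun ϖ ψ ℓ σ u w (h.1 * g) = _
  have hhM := lowerTriMod_anti (halfSucc_le hℓ) h.2
  by_cases hg : g ∈ lowerTriMod 𝒪[F] (halfSucc ℓ)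
  · have hhg := mul_mem hhM hg
    have ug := isUnit_apply_of_mem_lowerTriMod (one_le_halfSucc ℓ) hg
    have uh := isUnit_apply_of_mem_lowerTriMod hℓ h.2
    have uhg := isUnit_apply_of_mem_lowerTriMod (one_le_halfSucc ℓ) hhg
    rw [kirillovFun, kirillovFun, if_pos hg, if_pos hhg, map_smul]
    have hw2 := diagSL_mem_whittaker hw (resUnit (g 0 0))
    rw [← residue_inverse ug, ← map_pow, ← map_mul] at hw2
    rw [twistedRep_apply hϖ hψ hℓ hw2, smul_smul, ← AddChar.map_add_eq_mul,
      ← Module.End.mul_apply, ← map_mul, ← diagSL_mul, ← resUnit_mul uh ug]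
    congr 1
    · refine levelChar_congr hϖ hψ ?_
      have := Ideal.mul_mem_left _ u
        (upperSlope_mul_sub_mem_left hℓ (one_le_halfSucc ℓ) h.2 hg)
      convert this using 1
      ring
    · rw [resUnit_congr uhg (uh.mul ug)]
      rw [SL2_mul_zero_zero, add_sub_cancel_left]
      exact Ideal.mul_mem_right _ _ (Ideal.pow_le_self (by omega) h.2)
  · have hhg : h.1 * g ∉ lowerTriMod 𝒪[F] (halfSucc ℓ) := fun hc =>
      hg ((Subgroup.mul_mem_cancel_left _ hhM).1 hc)
    rw [kirillovFun, kirillovFun, if_neg hg, if_neg hhg, map_zero]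

/-- The function `kirillovFun`, as an element of the Mackey component. -/
def kirillovVec (hℓ : 1 ≤ ℓ) {u : 𝒪[F]} {w : V}
    (hw : w ∈ whittaker σ ((residueChar hψ).mulShift (IsLocalRing.residue 𝒪[F] u))) :
    Representation.coindV (lowerTriMod 𝒪[F] ℓ).subtype (twistedRep hϖ σ ℓ) :=
  ⟨kirillovFun ϖ ψ ℓ σ u w, kirillovFun_mem hϖ hψ hℓ hw⟩

theorem kirillovVec_ne_zero (hℓ : 1 ≤ ℓ) {u : 𝒪[F]} {w : V}
    (hw : w ∈ whittaker σ ((residueChar hψ).mulShift (IsLocalRing.residue 𝒪[F] u)))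
    (hw0 : w ≠ 0) : kirillovVec hϖ hψ hℓ hw ≠ 0 := by
  intro h
  have h1 : kirillovFun ϖ ψ ℓ σ u w 1 = 0 := congrFun (congrArg Subtype.val h) 1
  rw [kirillovFun, if_pos (one_mem _)] at h1
  have h2 := (smul_eq_zero.1 h1).resolve_left (AddChar.val_isUnit _ _).ne_zero
  exact hw0 (by rw [← σ.inv_self_apply (diagSL (resUnit ((1 : SL(2, 𝒪[F])) 0 0))) w, h2, map_zero])

/-- The slope of gh is the sum of the slopes modulo P^{ℓ+1}, which produces the character. Since
(h₁₁ − 1)² = h₁₁² − 1 = 0 in the residue field of characteristic 2, right translation by h leaves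
the diagonal factor unchanged. -/
theorem mackeyComponent_kirillovVec [CharP 𝓀[F] 2] (hℓ : 1 ≤ ℓ) (u : 𝒪[F]ˣ) {w : V}
    (hw : w ∈ whittaker σ ((residueChar hψ).mulShift (IsLocalRing.residue 𝒪[F] u)))
    (h : intGroupSL 𝒪[F] ℓ) :
    mackeyComponent hϖ σ ℓ h (kirillovVec hϖ hψ hℓ hw) =
      etaHat hϖ hψ u ℓ h • kirillovVec hϖ hψ hℓ hw := by
  ext g
  change kirillovFun ϖ ψ ℓ σ u w (g * h.1) = etaHat hϖ hψ u ℓ h • kirillovFun ϖ ψ ℓ σ u w g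
  have hhM := intGroupSL_le ℓ h.2
  by_cases hg : g ∈ lowerTriMod 𝒪[F] (halfSucc ℓ)
  · have hgh := mul_mem hg hhM
    have ug := isUnit_apply_of_mem_lowerTriMod (one_le_halfSucc ℓ) hg
    have uh := isUnit_apply_of_mem_lowerTriMod (one_le_halfSucc ℓ) hhM
    have ugh := isUnit_apply_of_mem_lowerTriMod (one_le_halfSucc ℓ) hgh
    rw [kirillovFun, kirillovFun, if_pos hg, if_pos hgh, etaHat_eq_levelChar, smul_smul,
      ← AddChar.map_add_eq_mul]
    congr 1
    · refine levelChar_congr hϖ hψ ?_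
      have := Ideal.mul_mem_left _ (u : 𝒪[F]) (upperSlope_mul_sub_mem hg h.2)
      convert this using 1
      ring
    · have h1 : resUnit (h.1 0 0) = 1 := by
        have hsq := Ideal.pow_le_self (n := halfCeil ℓ) (by unfold halfCeil; omega) (sq_sub_one_mem h.2)
        have h2 : IsLocalRing.residue 𝒪[F] (h.1 0 0 ^ 2 - 1) = 0 :=
          Ideal.Quotient.eq_zero_iff_mem.2 hsq
        have h3 : (2 : 𝓀[F]) = 0 := CharP.cast_eq_zero 𝓀[F] 2
        rw [map_sub, map_pow, map_one, ← coe_resUnit uh] at h2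
        ext
        rw [Units.val_one, ← sub_eq_zero]
        refine eq_zero_of_pow_eq_zero (n := 2) ?_
        linear_combination h2 - ((resUnit (h.1 0 0) : 𝓀[F]) - 1) * h3
      have h4 : resUnit ((g * h.1) 0 0) = resUnit (g 0 0) := by
        rw [← mul_one (resUnit (g 0 0)), ← h1, ← resUnit_mul ug uh]
        refine resUnit_congr ugh (ug.mul uh) ?_
        rw [SL2_mul_zero_zero, add_sub_cancel_left]
        exact Ideal.mul_mem_right _ _ (Ideal.pow_le_self (n := halfSucc ℓ) (by unfold halfSucc; omega) hg)
      rw [h4]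
  · have hgh : g * h.1 ∉ lowerTriMod 𝒪[F] (halfSucc ℓ) := fun hc =>
      hg ((Subgroup.mul_mem_cancel_right _ hhM).1 hc)
    rw [kirillovFun, kirillovFun, if_neg hg, if_neg hgh, smul_zero]

/-- Right multiplication by the diagonal matrix of s multiplies the slope by s⁻², so translation
moves u within its class modulo squares. -/
theorem kirillovFun_mul_diagSL (u : 𝒪[F]) (w : V) (s : 𝒪[F]ˣ) (g : SL(2, 𝒪[F])) :
    kirillovFun ϖ ψ ℓ σ u w (g * diagSL s) =
      kirillovFun ϖ ψ ℓ σ (u * ((s⁻¹ : 𝒪[F]ˣ) : 𝒪[F]) ^ 2) (σ (diagSL (resUnit (s : 𝒪[F]))) w) g := by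
  have hs : diagSL s ∈ lowerTriMod 𝒪[F] (halfSucc ℓ) := by
    change diagSL s 0 1 ∈ maxPow 𝒪[F] (halfSucc ℓ)
    simp
  by_cases hg : g ∈ lowerTriMod 𝒪[F] (halfSucc ℓ)
  · have hgs := mul_mem hg hs
    have ug := isUnit_apply_of_mem_lowerTriMod (one_le_halfSucc ℓ) hg
    have ugs := isUnit_apply_of_mem_lowerTriMod (one_le_halfSucc ℓ) hgs
    have e00 : (g * diagSL s) 0 0 = g 0 0 * s := by simp [SL2_mul_zero_zero]
    have e01 : (g * diagSL s) 0 1 = g 0 1 * ((s⁻¹ : 𝒪[F]ˣ) : 𝒪[F]) := by simp [SL2_mul_zero_one]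
    rw [kirillovFun, kirillovFun, if_pos hg, if_pos hgs, e00, resUnit_mul ug s.isUnit, diagSL_mul,
      map_mul σ, Module.End.mul_apply]
    have sg := mul_upperSlope ug
    have sgs := mul_upperSlope ugs
    rw [e00, e01] at sgs
    have : upperSlope (g * diagSL s) = ((s⁻¹ : 𝒪[F]ˣ) : 𝒪[F]) ^ 2 * upperSlope g := by
      refine (ug.mul s.isUnit).mul_left_cancel ?_
      rw [sgs]
      linear_combination (-((s⁻¹ : 𝒪[F]ˣ) : 𝒪[F])) * sg -
        (((s⁻¹ : 𝒪[F]ˣ) : 𝒪[F]) * (g 0 0 * upperSlope g)) * s.mul_inv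
    rw [this, mul_assoc]
  · have hgs : g * diagSL s ∉ lowerTriMod 𝒪[F] (halfSucc ℓ) := fun hc =>
      hg ((Subgroup.mul_mem_cancel_right _ hs).1 hc)
    rw [kirillovFun, kirillovFun, if_neg hg, if_neg hgs]

-- On the support the slope lies in P^{m'}, and m + m' = ℓ + 1, so only u modulo P^m matters.
include hϖ hψ in
theorem kirillovFun_congr {u v : 𝒪[F]} (huv : u - v ∈ maxPow 𝒪[F] (halfCeil ℓ)) (w : V) :
    kirillovFun ϖ ψ ℓ σ u w = kirillovFun ϖ ψ ℓ σ v w := by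
  ext g
  by_cases hg : g ∈ lowerTriMod 𝒪[F] (halfSucc ℓ)
  · rw [kirillovFun, kirillovFun, if_pos hg, if_pos hg]
    congr 1
    refine levelChar_congr hϖ hψ ?_
    rw [← sub_mul]
    have h1 := halfSucc_add_halfCeil ℓ
    exact mul_mem_maxPow huv ((upperSlope_mem (one_le_halfSucc ℓ) hg).2 hg) (by omega)
  · rw [kirillovFun, kirillovFun, if_neg hg, if_neg hg]

theorem kirillovFun_smul (u : 𝒪[F]) (c : ℂ) (w : V) :
    kirillovFun ϖ ψ ℓ σ u (c • w) = c • kirillovFun ϖ ψ ℓ σ u w := by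
  ext g
  by_cases hg : g ∈ lowerTriMod 𝒪[F] (halfSucc ℓ)
  · rw [Pi.smul_apply, kirillovFun, kirillovFun, if_pos hg, if_pos hg, map_smul, smul_comm]
  · rw [Pi.smul_apply, kirillovFun, kirillovFun, if_neg hg, if_neg hg, smul_zero]

include hϖ hψ in
/-- Orthogonality of the characters of `P / P ^ m`. -/
theorem sum_levelChar (hℓ : 1 ≤ ℓ) [Fintype (𝒪[F] ⧸ maxPow 𝒪[F] (halfCeil ℓ - 1))] {x : 𝒪[F]}
    (hx : x ∈ maxPow 𝒪[F] (halfSucc ℓ)) (hx' : x ∉ maxPow 𝒪[F] ℓ) :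
    ∑ q : 𝒪[F] ⧸ maxPow 𝒪[F] (halfCeil ℓ - 1), levelChar ϖ ψ ℓ (ϖ * quotRep _ q * x) = 0 := by
  have hsum := halfSucc_add_halfCeil ℓ
  have h1 : 1 ≤ halfCeil ℓ := by unfold halfCeil; omega
  have hmk : ∀ a b : 𝒪[F], Ideal.Quotient.mk (maxPow 𝒪[F] (halfCeil ℓ - 1)) a =
      Ideal.Quotient.mk (maxPow 𝒪[F] (halfCeil ℓ - 1)) b →
      levelChar ϖ ψ ℓ (ϖ * a * x) = levelChar ϖ ψ ℓ (ϖ * b * x) := by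
    intro a b hab
    refine levelChar_congr hϖ hψ ?_
    have h2 := mul_mem_maxPow (n := ℓ)
      ((Ideal.Quotient.mk_eq_mk_iff_sub_mem a b).1 hab) hx (by omega)
    have h3 := mul_mem_maxPow (a := 1) (n := ℓ + 1)
      ((mem_maxPow_iff hϖ).2 (by rw [pow_one])) h2 (by omega)
    convert h3 using 1
    ring
  have hout := mk_quotRep (maxPow 𝒪[F] (halfCeil ℓ - 1))
  let θ : AddChar (𝒪[F] ⧸ maxPow 𝒪[F] (halfCeil ℓ - 1)) ℂ :=
    { toFun := fun q => levelChar ϖ ψ ℓ (ϖ * quotRep _ q * x)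
      map_zero_eq_one' := by
        rw [hmk _ 0 (by rw [hout, map_zero]), mul_zero, zero_mul, AddChar.map_zero_eq_one]
      map_add_eq_mul' := fun a b => by
        rw [hmk _ (quotRep _ a + quotRep _ b) (by rw [hout, map_add, hout, hout]), mul_add, add_mul,
          AddChar.map_add_eq_mul] }
  refine AddChar.sum_eq_zero_of_ne_one (ψ := θ) fun hθ => hx' ?_
  -- If θ were trivial, ϖx would annihilate the whole ring, which is the case n = 0 of the duality;
  -- cancelling ϖ would put x in P^ℓ.
  have h2 : ϖ * x ∈ maxPow 𝒪[F] (ℓ + 1 - 0) := by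
    refine mem_maxPow_of_levelChar hϖ hψ (Nat.zero_le ℓ) fun r _ => ?_
    have h3 : θ (Ideal.Quotient.mk _ r) = 1 := by rw [hθ]; rfl
    rw [← h3, show ϖ * x * r = ϖ * r * x by ring]
    exact hmk _ _ (hout _).symm
  obtain ⟨y, hy⟩ := (mem_maxPow_iff hϖ).1 h2
  refine (mem_maxPow_iff hϖ).2 ⟨y, mul_left_cancel₀ hϖ.ne_zero ?_⟩
  rw [hy, Nat.sub_zero, pow_succ]
  ring

theorem residue_add_uniformizer_mul (hϖ : Irreducible ϖ) (u r : 𝒪[F]) :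
    IsLocalRing.residue 𝒪[F] (u + ϖ * r) = IsLocalRing.residue 𝒪[F] u := by
  have := residue_pow_mul hϖ le_rfl r
  rw [pow_one] at this
  rw [map_add, this, add_zero]

/-- The elements u + ϖq run over the lifts modulo P^m of the residue class of u. Orthogonality kills
the sum where the slope is outside P^ℓ, and on B'_ℓ all summands agree. -/
theorem sum_kirillovVec (hℓ : 1 ≤ ℓ) [Fintype (𝒪[F] ⧸ maxPow 𝒪[F] (halfCeil ℓ - 1))]
    {u : 𝒪[F]} {w : V}
    (hw : w ∈ whittaker σ ((residueChar hψ).mulShift (IsLocalRing.residue 𝒪[F] u))) :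
    ∑ q : 𝒪[F] ⧸ maxPow 𝒪[F] (halfCeil ℓ - 1),
      kirillovVec hϖ hψ hℓ (u := u + ϖ * quotRep _ q) (w := w)
        (by rwa [residue_add_uniformizer_mul hϖ]) =
      (Fintype.card (𝒪[F] ⧸ maxPow 𝒪[F] (halfCeil ℓ - 1)) : ℂ) •
        indPoint (twistedRep hϖ σ ℓ) w := by
  ext g
  rw [AddSubmonoidClass.coe_finsetSum, Finset.sum_apply]
  change ∑ q, kirillovFun ϖ ψ ℓ σ (u + ϖ * quotRep _ q) w g =
    (Fintype.card (𝒪[F] ⧸ maxPow 𝒪[F] (halfCeil ℓ - 1)) : ℂ) •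
      (indPoint (twistedRep hϖ σ ℓ) w).1 g
  by_cases hg : g ∈ lowerTriMod 𝒪[F] (halfSucc ℓ)
  · simp only [kirillovFun, if_pos hg, add_mul, AddChar.map_add_eq_mul, mul_smul]
    rw [← Finset.smul_sum, ← Finset.sum_smul]
    by_cases hgB : g ∈ lowerTriMod 𝒪[F] ℓ
    · rw [indPoint_of_mem _ _ hgB, twistedRep_apply hϖ hψ hℓ hw]
      have h1 : ∀ q : 𝒪[F] ⧸ maxPow 𝒪[F] (halfCeil ℓ - 1),
          levelChar ϖ ψ ℓ (ϖ * quotRep _ q * upperSlope g) = 1 := by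
        intro q
        refine levelChar_eq_one hϖ hψ ?_
        refine mul_mem_maxPow (a := 1) ((mem_maxPow_iff hϖ).2 ?_)
          ((upperSlope_mem (one_le_halfSucc ℓ) hg).2 hgB) (by omega)
        rw [pow_one]
        exact Dvd.intro _ rfl
      rw [Finset.sum_congr rfl fun q _ => h1 q, Finset.sum_const, Finset.card_univ, nsmul_eq_mul,
        mul_one, smul_comm]
    · rw [indPoint_of_notMem _ _ hgB, sum_levelChar hϖ hψ hℓ
        ((upperSlope_mem (one_le_halfSucc ℓ) hg).2 hg)
        (fun h => hgB ((upperSlope_mem (one_le_halfSucc ℓ) hg).1 h)), zero_smul, smul_zero, smul_zero]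
  · have hgB : g ∉ lowerTriMod 𝒪[F] ℓ := fun h => hg (lowerTriMod_anti (halfSucc_le hℓ) h)
    simp only [kirillovFun, if_neg hg, indPoint_of_notMem _ _ hgB, Finset.sum_const_zero, smul_zero]

/-- A stable subspace of the Mackey component that contains a nonzero vector `kirillovVec` for each
square class is the whole space. -/
theorem mem_of_kirillovVec_mem (hσ : IsCuspidal σ) (hℓ : 1 ≤ ℓ) {S : Set 𝒪[F]ˣ}
    (hS : IsSquareClassReps 𝒪[F] (halfCeil ℓ) S)
    {T : Submodule ℂ
      (Representation.coindV (lowerTriMod 𝒪[F] ℓ).subtype (twistedRep hϖ σ ℓ))}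
    (hT : ∀ g, ∀ f ∈ T, mackeyComponent hϖ σ ℓ g f ∈ T)
    (hTS : ∀ u ∈ S, ∃ (w : V) (hw : w ∈ whittaker σ
      ((residueChar hψ).mulShift (IsLocalRing.residue 𝒪[F] (u : 𝒪[F])))),
      w ≠ 0 ∧ kirillovVec hϖ hψ hℓ hw ∈ T)
    (f : Representation.coindV (lowerTriMod 𝒪[F] ℓ).subtype (twistedRep hϖ σ ℓ)) : f ∈ T := by
  classical
  have : Fintype 𝓀[F] := Fintype.ofFinite _
  have hψ1 := residueChar_ne_one hψ
  have hprim := AddChar.IsPrimitive.of_ne_one hψ1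
  -- A diagonal translation takes the given vector for u to one for v with some nonzero Whittaker
  -- vector; by multiplicity one, any other w is a multiple of that vector.
  have hall : ∀ (v : 𝒪[F]ˣ) (w : V) (hw : w ∈ whittaker σ
      ((residueChar hψ).mulShift (IsLocalRing.residue 𝒪[F] (v : 𝒪[F])))),
      kirillovVec hϖ hψ hℓ hw ∈ T := by
    intro v w hw
    obtain ⟨u, hu, a, ha⟩ := hS.exists_sub_mem v
    obtain ⟨w₀, hw₀, hw₀0, hmem⟩ := hTS u hu
    have hmem2 := hT (diagSL a⁻¹) _ hmem
    set d := diagSL (resUnit ((a⁻¹ : 𝒪[F]ˣ) : 𝒪[F])) with hd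
    have hw₁ : σ d w₀ ∈ whittaker σ
        ((residueChar hψ).mulShift (IsLocalRing.residue 𝒪[F] (v : 𝒪[F]))) := by
      have h1 := diagSL_mem_whittaker hw₀ (resUnit ((a⁻¹ : 𝒪[F]ˣ) : 𝒪[F]))
      rw [← residue_inverse a⁻¹.isUnit, Ring.inverse_unit, inv_inv, ← map_pow, ← map_mul] at h1
      have h2 : IsLocalRing.residue 𝒪[F] ((u : 𝒪[F]) * (a : 𝒪[F]) ^ 2 - v) = 0 :=
        Ideal.Quotient.eq_zero_iff_mem.2 (Ideal.pow_le_self (n := halfCeil ℓ) (by unfold halfCeil; omega) ha)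
      rw [map_sub, sub_eq_zero] at h2
      rwa [h2] at h1
    have hw₁0 : σ d w₀ ≠ 0 := fun h => hw₀0 (by rw [← σ.inv_self_apply d w₀, h, map_zero])
    obtain ⟨c, hc⟩ := exists_smul_eq_of_mem_whittaker hσ.1
      (hprim (v.isUnit.map (IsLocalRing.residue 𝒪[F])).ne_zero) hw₁ hw₁0 hw
    have heq : kirillovVec hϖ hψ hℓ hw =
        c • mackeyComponent hϖ σ ℓ (diagSL a⁻¹) (kirillovVec hϖ hψ hℓ hw₀) := by
      ext g
      change kirillovFun ϖ ψ ℓ σ v w g = c • kirillovFun ϖ ψ ℓ σ u w₀ (g * diagSL a⁻¹)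
      rw [kirillovFun_mul_diagSL, inv_inv, kirillovFun_congr hϖ hψ ha, ← Pi.smul_apply,
        ← kirillovFun_smul, hc]
    rw [heq]
    exact Submodule.smul_mem _ _ hmem2
  refine mem_of_indPoint_mem _ hT (fun w => ?_) f
  have hwtop : w ∈ ⨆ a : (𝓀[F])ˣ, whittaker σ ((residueChar hψ).mulShift a) := by
    rw [iSup_whittaker_eq_top hσ hψ1]
    trivial
  induction hwtop using Submodule.iSup_induction' with
  | mem a w hw =>
    obtain ⟨u, hu⟩ := IsLocalRing.residue_surjective (a : 𝓀[F])
    have huu : IsUnit u := by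
      by_contra h
      exact a.ne_zero (hu ▸ Ideal.Quotient.eq_zero_iff_mem.2 h)
    rw [← hu] at hw
    have := finite_quotient_maxPow (F := F) (halfCeil ℓ - 1)
    have : Fintype (𝒪[F] ⧸ maxPow 𝒪[F] (halfCeil ℓ - 1)) := Fintype.ofFinite _
    have hsum := sum_kirillovVec hϖ hψ hℓ hw
    have hne : (Fintype.card (𝒪[F] ⧸ maxPow 𝒪[F] (halfCeil ℓ - 1)) : ℂ) ≠ 0 := by simp
    rw [← Submodule.smul_mem_iff T hne, ← hsum]
    refine Submodule.sum_mem _ fun q _ => ?_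
    have hunit : IsUnit (u + ϖ * quotRep _ q) := by
      by_contra h
      have h1 : IsLocalRing.residue 𝒪[F] (u + ϖ * quotRep _ q) = 0 := Ideal.Quotient.eq_zero_iff_mem.2 h
      rw [residue_add_uniformizer_mul hϖ, hu] at h1
      exact a.ne_zero h1
    exact hall hunit.unit w _
  | zero =>
    rw [show indPoint (twistedRep hϖ σ ℓ) 0 = 0 from ?_]
    · exact zero_mem _
    · ext g
      by_cases hg : g ∈ lowerTriMod 𝒪[F] ℓ
      · rw [indPoint_of_mem _ _ hg, map_zero]; rfl
      · rw [indPoint_of_notMem _ _ hg]; rfl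
  | add x y _ _ hx hy =>
    rw [show indPoint (twistedRep hϖ σ ℓ) (x + y) =
      indPoint (twistedRep hϖ σ ℓ) x + indPoint (twistedRep hϖ σ ℓ) y from ?_]
    · exact add_mem hx hy
    · ext g
      change _ = (indPoint (twistedRep hϖ σ ℓ) x).1 g + (indPoint (twistedRep hϖ σ ℓ) y).1 g
      by_cases hg : g ∈ lowerTriMod 𝒪[F] ℓ
      · rw [indPoint_of_mem _ _ hg, indPoint_of_mem _ _ hg, indPoint_of_mem _ _ hg, map_add]
      · rw [indPoint_of_notMem _ _ hg, indPoint_of_notMem _ _ hg, indPoint_of_notMem _ _ hg,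
          add_zero]

end MackeyComponent

/-! ### The decomposition of the Mackey component -/

theorem corollary7p6 {F : Type*} [Field F] [ValuativeRel F] [TopologicalSpace F]
    [IsNonarchimedeanLocalField F] [CharP 𝓀[F] 2]
    {ϖ : 𝒪[F]} (hϖ : Irreducible ϖ)
    {ψ : AddChar F ℂ} (hψ : HasConductorMaximalIdeal ψ)
    {V : Type*} [AddCommGroup V] [Module ℂ V]
    (σ : Representation ℂ SL(2, 𝓀[F]) V) (hσ : IsCuspidal σ)
    (ℓ : ℕ) (hℓ : 1 ≤ ℓ)
    (S : Set 𝒪[F]ˣ) (hS : IsSquareClassReps 𝒪[F] (halfCeil ℓ) S) :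
    Nonempty ((mackeyComponent hϖ σ ℓ).Equiv
      (Representation.directSum fun u : S => repI hϖ hψ (u : 𝒪[F]ˣ) ℓ)) ∧
    (∀ u ∈ S, (repI hϖ hψ u ℓ).IsIrreducible) ∧
    (∀ u ∈ S, ∀ u' ∈ S, u ≠ u' → IsEmpty ((repI hϖ hψ u ℓ).Equiv (repI hϖ hψ u' ℓ))) := by
  classical
  have hχ : ∀ (u u' : S) (k : SL(2, 𝒪[F])),
      Intertwines (etaHat hϖ hψ (u : 𝒪[F]ˣ) ℓ) (etaHat hϖ hψ (u' : 𝒪[F]ˣ) ℓ) k →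
        u = u' ∧ k ∈ intGroupSL 𝒪[F] ℓ := eq_and_mem_of_intertwines hϖ hψ hℓ hS
  have hN := principalCongr_le_intGroupSL (F := F) ℓ
  have hχN : ∀ (u : S) (n : intGroupSL 𝒪[F] ℓ), (n : SL(2, 𝒪[F])) ∈ principalCongr 𝒪[F] (ℓ + 1) →
      etaHat hϖ hψ (u : 𝒪[F]ˣ) ℓ n = 1 :=
    fun u n hn => etaHat_eq_one_of_mem_principalCongr hϖ hψ u n hn
  refine ⟨?_, fun u hu => isIrreducible_indRep hχ hN hχN ⟨u, hu⟩, fun u hu u' hu' hne =>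
    isEmpty_equiv_indRep hχ (i := ⟨u, hu⟩) (j := ⟨u', hu'⟩)
      fun h => hne (congrArg Subtype.val h)⟩
  have : Fintype 𝓀[F] := Fintype.ofFinite _
  have hw : ∀ u : S, ∃ w ∈ whittaker σ
      ((residueChar hψ).mulShift (IsLocalRing.residue 𝒪[F] ((u : 𝒪[F]ˣ) : 𝒪[F]))), w ≠ 0 :=
    fun u => exists_mem_whittaker_ne_zero hσ (residueChar_ne_one hψ)
      (Units.map (IsLocalRing.residue 𝒪[F] : 𝒪[F] →* 𝓀[F]) u)
  choose w hw hw0 using hw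
  let Φ : ∀ u : S, (repI hϖ hψ (u : 𝒪[F]ˣ) ℓ).IntertwiningMap (mackeyComponent hϖ σ ℓ) :=
    fun u => indLift _ (mackeyComponent_kirillovVec hϖ hψ hℓ (u : 𝒪[F]ˣ) (hw u))
  let Ψ : (Representation.directSum fun u : S => repI hϖ hψ (u : 𝒪[F]ˣ) ℓ).IntertwiningMap
      (mackeyComponent hϖ σ ℓ) :=
    { toLinearMap := DirectSum.toModule ℂ S _ fun u => (Φ u).toLinearMap
      isIntertwining' := fun g => by
        refine DirectSum.linearMap_ext _ fun u => LinearMap.ext fun f => ?_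
        have h1 : (Representation.directSum fun u : S => repI hϖ hψ (u : 𝒪[F]ˣ) ℓ) g
            (DirectSum.lof ℂ S _ u f) = DirectSum.lof ℂ S _ u (repI hϖ hψ (u : 𝒪[F]ˣ) ℓ g f) :=
          DirectSum.lmap_lof (fun u : S => repI hϖ hψ (u : 𝒪[F]ˣ) ℓ g) u f
        simp only [LinearMap.comp_apply, h1, DirectSum.toModule_lof]
        exact (Φ u).isIntertwining _ _ g f }
  have hΨ : ∀ u : S, Ψ (DirectSum.lof ℂ S
      (fun u : S => Representation.coindV (intGroupSL 𝒪[F] ℓ).subtype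
        (charRep (etaHat hϖ hψ (u : 𝒪[F]ˣ) ℓ))) u
      (charPoint (etaHat hϖ hψ (u : 𝒪[F]ˣ) ℓ))) = kirillovVec hϖ hψ hℓ (hw u) := by
    intro u
    refine (DirectSum.toModule_lof ℂ u _).trans ?_
    exact indLift_charPoint _ _
  have hinj : Function.Injective Ψ := by
    refine injective_of_lof_charPoint_ne_zero hχ hN hχN Ψ fun u => ?_
    exact fun h => kirillovVec_ne_zero hϖ hψ hℓ (hw u) (hw0 u) ((hΨ u).symm.trans h)
  have hsurj : Function.Surjective Ψ := by
    refine fun f => mem_of_kirillovVec_mem hϖ hψ hσ hℓ hS (T := Ψ.toLinearMap.range) ?_ ?_ f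
    · rintro g _ ⟨x, rfl⟩
      exact ⟨_, Ψ.isIntertwining _ _ g x⟩
    · exact fun u hu => ⟨w ⟨u, hu⟩, hw ⟨u, hu⟩, hw0 _, _, hΨ ⟨u, hu⟩⟩
  exact ⟨(Ψ.ofBijective ⟨hinj, hsurj⟩).symm⟩
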